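/- Theorem 1. Let $M\subset\mathbb R^n\times\mathbb R^n$ be an open set of points $x=(p,q)$ (momenta $p$, positions $q$), invariant under $(p,q)\mapsto(-p,q)$, and let $H_0,A:M\to\mathbb R$ be of class $C^2$ and even in the momenta, i.e. $H_0(-p,q)=H_0(p,q)$ and $A(-p,q)=A(p,q)$, with $H_0$ bounded from below. Let $\beta>0$, assume $Z_0=\int_M e^{-\beta H_0}\,dp\,dq<\infty$, put $\rho_0=Z_0^{-1}e^{-\beta H_0}$ and $\|f\|_0=\big(\int_M |f|^2\rho_0\,dp\,dq\big)^{1/2}\in[0,\infty]$, and write $[f,g]=\sum_i\big(\frac{\partial f}{\partial q_i}\frac{\partial g}{\partial p_i}-\frac{\partial f}{\partial p_i}\frac{\partial g}{\partial q_i}\big)$ for the Poisson bracket. For $h>0$ let $H_1=H_0-hA$ be the perturbed Hamiltonian, and assume that for all sufficiently small $h>0$ all solutions of Hamilton's equations of $H_1$ in $M$ exist for all times. Assume that there are $\delta>0$ and $K>0$ with $$\int_M e^{\delta A}\rho_0\,dp\,dq<K\quad\text{and}\quad\int_M e^{-\delta A}\rho_0\,dp\,dq<K,$$ and that, with $B=[A,H_0]$,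 $$\|B^4\|_0<\infty,\qquad \|[B,H_0]^2\|_0<\infty,\qquad \|[B,A]^2\|_0<\infty .$$ Let $\eta>0$ be such that $\|[B,H_0]\|_0\le\eta\,\|B\|_0$. For small $h>0$ let $\rho(t)$, $t\ge0$, be the classical solution on $M$ (continuous for $t\ge 0$ and $C^1$ for $t>0$) of Liouville's equation $\partial_t\rho=[H_1,\rho]$ with $\rho(0)=\rho_0$; let $\langle B\rangle(t)=\int_M B\,\rho(t)\,dp\,dq$ and $\Delta\langle B\rangle(t)=\langle B\rangle(t)-\langle B\rangle(0)$; and let $t_{relax}=t_{relax}(h)\in[0,+\infty]$ be the supremum of all $t^*$ such that $\langle B\rangle(t)$ is well defined (the integral converges absolutely, also at $t=0$) and $\frac{d}{dt}\Delta\langle B\rangle(t)$ exists and is $\ge0$ for all $0<t<t^*$. Then $$t_{relax}\ \ge\ \frac{\sqrt2}{\eta}+o(1)\qquad\text{as }h\to0^+ .$$ -/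

import Mathlib

open Set Filter Topology MeasureTheory

noncomputable section

/-- Canonical phase space with `n` degrees of freedom. A point is a pair `x = (p, q)`:
`x.1` are the momenta and `x.2` the positions. Its `volume` is Lebesgue measure `dp dq`. -/
abbrev PhaseSpace (n : ℕ) : Type := (Fin n → ℝ) × (Fin n → ℝ)

/-- The partial derivative `∂f/∂p_i`. -/
def partialP {n : ℕ} (f : PhaseSpace n → ℝ) (i : Fin n) (x : PhaseSpace n) : ℝ :=
  fderiv ℝ f x (Pi.single i 1, 0)

/-- The partial derivative `∂f/∂q_i`. -/
def partialQ {n : ℕ} (f : PhaseSpace n → ℝ) (i : Fin n) (x : PhaseSpace n) : ℝ :=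
  fderiv ℝ f x (0, Pi.single i 1)

/-- The Poisson bracket `[f, g] = ∑ i, (∂f/∂q_i ∂g/∂p_i - ∂f/∂p_i ∂g/∂q_i)`, so that `[f, H]` is
the time derivative of `f` along the motions with Hamiltonian `H`. -/
def poissonBracket {n : ℕ} (f g : PhaseSpace n → ℝ) (x : PhaseSpace n) : ℝ :=
  ∑ i, (partialQ f i x * partialP g i x - partialP f i x * partialQ g i x)

/-- The Hamiltonian vector field of `H`: `p' = -∂H/∂q`, `q' = ∂H/∂p`. -/
def hamiltonianVectorField {n : ℕ} (H : PhaseSpace n → ℝ) (x : PhaseSpace n) : PhaseSpace n :=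
  (fun i => -partialQ H i x, fun i => partialP H i x)

/-- The Hamiltonian flow of `H` on `M` is global: through each point of `M` there passes
a solution of Hamilton's equations that is defined for all times and stays in `M`. -/
def HasGlobalFlow {n : ℕ} (M : Set (PhaseSpace n)) (H : PhaseSpace n → ℝ) : Prop :=
  ∀ x ∈ M, ∃ γ : ℝ → PhaseSpace n, γ 0 = x ∧ (∀ t, γ t ∈ M) ∧
    IsIntegralCurve γ (fun _ => hamiltonianVectorField H)

/-- `M` is invariant under reversal of the momenta, and `f` is even in the momenta on `M`. -/
def EvenInMomenta {n : ℕ} (M : Set (PhaseSpace n)) (f : PhaseSpace n → ℝ) : Prop :=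
  ∀ x ∈ M, (-x.1, x.2) ∈ M ∧ f (-x.1, x.2) = f x

/-- The Gibbs density `exp (-β H) / Z` on `M`, where `Z = ∫_M exp (-β H) dp dq`. -/
def gibbsDensity {n : ℕ} (M : Set (PhaseSpace n)) (β : ℝ) (H : PhaseSpace n → ℝ)
    (x : PhaseSpace n) : ℝ :=
  Real.exp (-β * H x) / ∫ y in M, Real.exp (-β * H y)

/-- The Gibbs measure on `M`: the measure whose density is `gibbsDensity M β H`. -/
def gibbsMeasure {n : ℕ} (M : Set (PhaseSpace n)) (β : ℝ) (H : PhaseSpace n → ℝ) :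
    Measure (PhaseSpace n) :=
  (volume.restrict M).withDensity (fun x => ENNReal.ofReal (gibbsDensity M β H x))

/-- The `L²` norm of `f` with respect to the Gibbs measure of `H`, with values in `[0, ∞]`. -/
def gibbsNorm {n : ℕ} (M : Set (PhaseSpace n)) (β : ℝ) (H f : PhaseSpace n → ℝ) : ENNReal :=
  eLpNorm f 2 (gibbsMeasure M β H)

/-- `ρ t x` is a classical solution, for times `t ≥ 0` and points `x ∈ M`, of Liouville's equation
`∂ρ/∂t = [H, ρ]` with initial condition `ρ 0 = ρ₀`. -/
structure IsLiouvilleSolution {n : ℕ} (M : Set (PhaseSpace n)) (H ρ₀ : PhaseSpace n → ℝ)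
    (ρ : ℝ → PhaseSpace n → ℝ) : Prop where
  continuousOn : ContinuousOn (fun z : ℝ × PhaseSpace n => ρ z.1 z.2) (Ici 0 ×ˢ M)
  contDiffOn : ContDiffOn ℝ 1 (fun z : ℝ × PhaseSpace n => ρ z.1 z.2) (Ioi 0 ×ˢ M)
  initial : ∀ x ∈ M, ρ 0 x = ρ₀ x
  equation : ∀ t, 0 < t → ∀ x ∈ M,
    HasDerivAt (fun s => ρ s x) (poissonBracket H (ρ t) x) t

/-- The increment `Δ⟨B⟩(t) = ⟨B⟩(t) - ⟨B⟩(0)`, where `⟨B⟩(t) = ∫_M B ρ(t) dp dq`. -/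
def deltaMean {n : ℕ} (M : Set (PhaseSpace n)) (B : PhaseSpace n → ℝ)
    (ρ : ℝ → PhaseSpace n → ℝ) (t : ℝ) : ℝ :=
  (∫ x in M, B x * ρ t x) - ∫ x in M, B x * ρ 0 x

/-- The relaxation time: the supremum, in the extended reals, of the `T` such that at all times
`0 < t < T` the derivative of `Δ⟨B⟩` exists and is nonnegative. That the expectation `⟨B⟩(t)`
exists, initially and at each such time, is part of the requirement. -/
def relaxationTime {n : ℕ} (M : Set (PhaseSpace n)) (B : PhaseSpace n → ℝ)
    (ρ : ℝ → PhaseSpace n → ℝ) : EReal :=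
  sSup ((fun T : ℝ => (T : EReal)) '' {T : ℝ | IntegrableOn (fun x => B x * ρ 0 x) M ∧
    ∀ t, 0 < t → t < T → IntegrableOn (fun x => B x * ρ t x) M ∧
      DifferentiableAt ℝ (deltaMean M B ρ) t ∧ 0 ≤ deriv (deltaMean M B ρ) t})

end

/-! Let `φ` be the flow of `H₀ - h * A` and `μ` the Gibbs measure. Liouville's equation transports
`ρ₀`, so `ρ(t) = ρ₀ ∘ φ(-t)`. Since `H₀ - h * A` is conserved, `H₀` grows along `φ` at the rate `h
B`, and `ρ₀ ∘ φ(-t)` has time derivative `β h (B ρ₀) ∘ φ(-t)`. Integrating against `B` and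
substituting the volume preserving map `φ(s)` gives `Δ⟨B⟩(t) = β h ∫₀ᵗ C(s) ds` with the
autocorrelation `C(s) = ∫ B · (B ∘ φ(s)) dμ` (`deltaMean_eq`). It remains to see how long `C ≥ 0`.

By polarization, `2 C(t) = ∫ B² + ∫ (B ∘ φ(t))² - ∫ (B ∘ φ(t) - B)²`. As `B` changes at the rate `G
= [B, H₀] - h [B, A]`, Cauchy–Schwarz in time bounds the last term by `t² sup_s ∫ (G ∘ φ(s))²`
(`integral_sq_sub_le`). If `μ` were invariant and the terms in `h` were dropped, this would give `2
C(t) ≥ (2 - η² t²) ∫ B²`, which is nonnegative up to `√2 / η`.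

In fact `μ` is almost invariant, uniformly in time (`gibbsMeasure_integral_comp`). Its image under
`φ(s)` has relative density `exp(-β h (A ∘ φ(-s) - A))`, whose second moment is at most the mean of
`(exp(3 β h A) + exp(-3 β h A)) / 2` and so has limit at most 1 as `h → 0`. Hence the means of `B²`
and `G²` along the flow differ little from their initial values; this costs fourth moments of `B`,
`[B, H₀]` and `[B, A]`. -/

/-! ### Complete flows of locally Lipschitz vector fields on an open set. -/

section Flow

theorem LocallyLipschitzOn.neg_right {E : Type*} [NormedAddCommGroup E] {M : Set E}
    {X : E → E} (hX : LocallyLipschitzOn M X) : LocallyLipschitzOn M (fun x => -X x) := by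
  intro x hx
  obtain ⟨K, t, ht, h⟩ := hX hx
  exact ⟨K, t, ht, fun y hy z hz => by simpa [edist_neg_neg] using h hy hz⟩

variable {E : Type*} [NormedAddCommGroup E] [NormedSpace ℝ E]

/-- Solutions of an autonomous equation that start close to a given solution depend on the initial
value in a Lipschitz way on compact time intervals. -/
theorem exists_forall_Icc_dist_le_mul_exp [ProperSpace E] {M : Set E} (hM : IsOpen M) {X : E → E}
    (hX : LocallyLipschitzOn M X) {γ₀ : ℝ → E} (h₀ : ∀ t, HasDerivAt γ₀ (X (γ₀ t)) t)
    (h₀M : ∀ t, γ₀ t ∈ M) (T : ℝ) :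
    ∃ r > 0, ∃ C : NNReal, ∀ γ₁ γ₂ : ℝ → E, (∀ t, HasDerivAt γ₁ (X (γ₁ t)) t) →
      (∀ t, HasDerivAt γ₂ (X (γ₂ t)) t) → dist (γ₁ 0) (γ₀ 0) ≤ r → dist (γ₂ 0) (γ₀ 0) ≤ r →
      ∀ t ∈ Icc 0 T, dist (γ₁ t) (γ₂ t) ≤ C * dist (γ₁ 0) (γ₂ 0) := by
  have cont : ∀ γ : ℝ → E, (∀ t, HasDerivAt γ (X (γ t)) t) → Continuous γ := fun γ h =>
    continuous_iff_continuousAt.2 fun t => (h t).continuousAt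
  have hΓ : IsCompact (γ₀ '' Icc 0 T) := isCompact_Icc.image (cont _ h₀)
  obtain ⟨δ, hδ, hδM⟩ := hΓ.exists_cthickening_subset_open hM (by rintro _ ⟨t, -, rfl⟩; exact h₀M t)
  obtain ⟨K, hK⟩ := (hX.mono hδM).exists_lipschitzOnWith_of_compact hΓ.cthickening
  have hin : ∀ (γ : ℝ → E) (t : ℝ), t ∈ Icc 0 T → dist (γ t) (γ₀ t) ≤ δ →
      γ t ∈ Metric.cthickening δ (γ₀ '' Icc 0 T) := fun γ t ht h =>
    Metric.mem_cthickening_of_dist_le _ _ _ _ (mem_image_of_mem _ ht) h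
  -- Grönwall applies as long as both curves stay in the thickened orbit, where `X` is
  -- `K`-Lipschitz.
  have gron : ∀ (γ₁ γ₂ : ℝ → E) (τ : ℝ), τ ≤ T → (∀ t, HasDerivAt γ₁ (X (γ₁ t)) t) →
      (∀ t, HasDerivAt γ₂ (X (γ₂ t)) t) →
      (∀ t ∈ Ico 0 τ, dist (γ₁ t) (γ₀ t) ≤ δ) → (∀ t ∈ Ico 0 τ, dist (γ₂ t) (γ₀ t) ≤ δ) →
      ∀ t ∈ Icc 0 τ, dist (γ₁ t) (γ₂ t) ≤ dist (γ₁ 0) (γ₂ 0) * Real.exp (K * T) := by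
    intro γ₁ γ₂ τ hτ h₁ h₂ d₁ d₂ t ht
    have := dist_le_of_trajectories_ODE_of_mem (v := fun _ => X)
      (s := fun _ => Metric.cthickening δ (γ₀ '' Icc 0 T)) (K := K) (fun _ _ => hK)
      (cont _ h₁).continuousOn (fun t _ => (h₁ t).hasDerivWithinAt)
      (fun t ht => hin _ _ ⟨ht.1, ht.2.le.trans hτ⟩ (d₁ t ht))
      (cont _ h₂).continuousOn (fun t _ => (h₂ t).hasDerivWithinAt)
      (fun t ht => hin _ _ ⟨ht.1, ht.2.le.trans hτ⟩ (d₂ t ht)) le_rfl t ht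
    refine this.trans ?_
    gcongr
    linarith [ht.2]
  -- A curve starting within `δ / 2 * exp (-(K * T))` stays in the tube: at the first time `τ` at
  -- distance `δ`, Grönwall up to `τ` would still give distance at most `δ / 2`.
  have stay : ∀ γ : ℝ → E, (∀ t, HasDerivAt γ (X (γ t)) t) →
      dist (γ 0) (γ₀ 0) ≤ δ / 2 * Real.exp (-(K * T)) → ∀ t ∈ Icc 0 T, dist (γ t) (γ₀ t) < δ := by
    intro γ h hr
    by_contra! hcon
    obtain ⟨t₁, ht₁, hd₁⟩ := hcon
    have hcl : IsClosed {t | δ ≤ dist (γ t) (γ₀ t)} :=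
      isClosed_le continuous_const ((cont _ h).dist (cont _ h₀))
    obtain ⟨τ, ⟨hτ, hτd⟩, hmin⟩ :=
      (isCompact_Icc.inter_right hcl).exists_isLeast (s := Icc 0 T ∩ _) ⟨t₁, ht₁, hd₁⟩
    have hlt : ∀ t ∈ Ico 0 τ, dist (γ t) (γ₀ t) ≤ δ := by
      intro t ht
      by_contra! hlt
      exact absurd (hmin ⟨⟨ht.1, ht.2.le.trans hτ.2⟩, hlt.le⟩) (not_le.2 ht.2)
    have := gron γ γ₀ τ hτ.2 h h₀ hlt (fun t _ => by simp [hδ.le]) τ ⟨hτ.1, le_rfl⟩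
    have h2 : dist (γ 0) (γ₀ 0) * Real.exp (K * T) ≤ δ / 2 := by
      calc _ ≤ δ / 2 * Real.exp (-(K * T)) * Real.exp (K * T) := by gcongr
        _ = δ / 2 := by rw [mul_assoc, ← Real.exp_add]; simp
    have h3 : δ ≤ dist (γ τ) (γ₀ τ) := hτd
    linarith
  refine ⟨δ / 2 * Real.exp (-(K * T)), by positivity, ⟨Real.exp (K * T), by positivity⟩, ?_⟩
  intro γ₁ γ₂ h₁ h₂ hr₁ hr₂ t ht
  have := gron γ₁ γ₂ T le_rfl h₁ h₂ (fun t ht => (stay _ h₁ hr₁ t ⟨ht.1, ht.2.le⟩).le)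
    (fun t ht => (stay _ h₂ hr₂ t ⟨ht.1, ht.2.le⟩).le) t ht
  rwa [mul_comm] at this

/-- Negative times reduce to positive ones, since the reversed curves solve the equation of `-X`. -/
theorem exists_forall_abs_le_dist_le [ProperSpace E] {M : Set E} (hM : IsOpen M) {X : E → E}
    (hX : LocallyLipschitzOn M X) {γ₀ : ℝ → E} (h₀ : ∀ t, HasDerivAt γ₀ (X (γ₀ t)) t)
    (h₀M : ∀ t, γ₀ t ∈ M) (T : ℝ) :
    ∃ r > 0, ∃ C : NNReal, ∀ γ₁ γ₂ : ℝ → E, (∀ t, HasDerivAt γ₁ (X (γ₁ t)) t) →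
      (∀ t, HasDerivAt γ₂ (X (γ₂ t)) t) → dist (γ₁ 0) (γ₀ 0) ≤ r → dist (γ₂ 0) (γ₀ 0) ≤ r →
      ∀ t, |t| ≤ T → dist (γ₁ t) (γ₂ t) ≤ C * dist (γ₁ 0) (γ₂ 0) := by
  have rev : ∀ γ : ℝ → E, (∀ t, HasDerivAt γ (X (γ t)) t) →
      ∀ t, HasDerivAt (fun s => γ (-s)) (-X (γ (-t))) t := by
    intro γ h t
    simpa [Function.comp_def] using (h (-t)).scomp t (hasDerivAt_neg t)
  obtain ⟨r, hr, C, H⟩ := exists_forall_Icc_dist_le_mul_exp hM hX h₀ h₀M T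
  obtain ⟨r', hr', C', H'⟩ := exists_forall_Icc_dist_le_mul_exp hM hX.neg_right (rev _ h₀)
    (fun t => h₀M _) T
  refine ⟨min r r', lt_min hr hr', max C C', fun γ₁ γ₂ h₁ h₂ d₁ d₂ t ht => ?_⟩
  rcases le_total 0 t with h | h
  · refine (H γ₁ γ₂ h₁ h₂ (d₁.trans (min_le_left _ _)) (d₂.trans (min_le_left _ _)) t
      ⟨h, (le_abs_self t).trans ht⟩).trans ?_
    gcongr
    exact le_max_left _ _
  · have := H' _ _ (rev _ h₁) (rev _ h₂) (by simpa using d₁.trans (min_le_right _ _))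
      (by simpa using d₂.trans (min_le_right _ _)) (-t) ⟨by linarith, (neg_le_abs t).trans ht⟩
    simp only [neg_neg, neg_zero] at this
    refine this.trans ?_
    gcongr
    exact le_max_right _ _

/-- Two integral curves in `M` of a locally Lipschitz vector field that agree at time `0` agree. -/
theorem integralCurve_unique [ProperSpace E] {M : Set E} (hM : IsOpen M) {X : E → E}
    (hX : LocallyLipschitzOn M X) {γ₀ γ₁ : ℝ → E} (h₀ : ∀ t, HasDerivAt γ₀ (X (γ₀ t)) t)
    (h₀M : ∀ t, γ₀ t ∈ M) (h₁ : ∀ t, HasDerivAt γ₁ (X (γ₁ t)) t) (h : γ₁ 0 = γ₀ 0) (t : ℝ) :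
    γ₁ t = γ₀ t := by
  obtain ⟨r, hr, C, H⟩ := exists_forall_abs_le_dist_le hM hX h₀ h₀M |t|
  have := H γ₁ γ₀ h₁ h₀ (by simp [h, hr.le]) (by simp [hr.le]) t le_rfl
  simpa [h] using this

/-- `φ` is the complete flow on `M` of the vector field `X`, extended by the identity. -/
structure IsCompleteFlow (M : Set E) (X : E → E) (φ : ℝ → E → E) : Prop where
  map_mem : ∀ t, ∀ x ∈ M, φ t x ∈ M
  map_zero : ∀ x, φ 0 x = x
  hasDerivAt : ∀ t, ∀ x ∈ M, HasDerivAt (fun s => φ s x) (X (φ t x)) t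
  map_notMem : ∀ t, ∀ x ∉ M, φ t x = x

theorem exists_isCompleteFlow {M : Set E} {X : E → E}
    (h : ∀ x ∈ M, ∃ γ : ℝ → E, γ 0 = x ∧ (∀ t, γ t ∈ M) ∧ ∀ t, HasDerivAt γ (X (γ t)) t) :
    ∃ φ, IsCompleteFlow M X φ := by
  classical
  choose γ h0 hm hd using h
  refine ⟨fun t x => if hx : x ∈ M then γ x hx t else x, ?_, ?_, ?_, ?_⟩
  · intro t x hx
    simpa [hx] using hm x hx t
  · intro x
    by_cases hx : x ∈ M <;> simp [hx, h0]
  · intro t x hx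
    simpa [hx] using hd x hx t
  · intro t x hx
    simp [hx]

namespace IsCompleteFlow

variable {M : Set E} {X : E → E} {φ : ℝ → E → E}

theorem map_mem_iff (h : IsCompleteFlow M X φ) {t : ℝ} {x : E} : φ t x ∈ M ↔ x ∈ M := by
  by_cases hx : x ∈ M
  · simp [hx, h.map_mem t x hx]
  · simp [hx, h.map_notMem t x hx]

theorem continuous_time (h : IsCompleteFlow M X φ) (x : E) : Continuous fun t => φ t x := by
  by_cases hx : x ∈ M
  · exact continuous_iff_continuousAt.2 fun t => (h.hasDerivAt t x hx).continuousAt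
  · simp only [h.map_notMem _ x hx]
    exact continuous_const

variable [ProperSpace E]

/-- Both sides are integral curves in `s` with the same value at `s = 0`. The extension by the
identity makes the group law hold on all of `E`. -/
theorem map_add (h : IsCompleteFlow M X φ) (hM : IsOpen M) (hX : LocallyLipschitzOn M X)
    (s t : ℝ) (x : E) : φ s (φ t x) = φ (s + t) x := by
  by_cases hx : x ∈ M
  · refine integralCurve_unique (γ₀ := fun s => φ (s + t) x) (γ₁ := fun s => φ s (φ t x)) hM hX
      (fun u => ?_) (fun u => h.map_mem _ _ hx) (fun u => h.hasDerivAt u _ (h.map_mem _ _ hx))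
      (by simp [h.map_zero]) s
    simpa using (h.hasDerivAt (u + t) x hx).comp_add_const u t
  · simp [h.map_notMem _ _ hx]

theorem map_neg_map (h : IsCompleteFlow M X φ) (hM : IsOpen M) (hX : LocallyLipschitzOn M X)
    (t : ℝ) (x : E) : φ (-t) (φ t x) = x := by
  rw [h.map_add hM hX, neg_add_cancel, h.map_zero]

theorem map_map_neg (h : IsCompleteFlow M X φ) (hM : IsOpen M) (hX : LocallyLipschitzOn M X)
    (t : ℝ) (x : E) : φ t (φ (-t) x) = x := by
  rw [h.map_add hM hX, add_neg_cancel, h.map_zero]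

theorem exists_dist_le (h : IsCompleteFlow M X φ) (hM : IsOpen M) (hX : LocallyLipschitzOn M X)
    {x : E} (hx : x ∈ M) (T : ℝ) :
    ∃ U ∈ 𝓝 x, U ⊆ M ∧ ∃ C : NNReal, ∀ t, |t| ≤ T → LipschitzOnWith C (φ t) U := by
  obtain ⟨r, hr, C, H⟩ := exists_forall_abs_le_dist_le hM hX (γ₀ := fun s => φ s x)
    (fun t => h.hasDerivAt t x hx) (fun t => h.map_mem t x hx) T
  refine ⟨Metric.closedBall x r ∩ M, inter_mem (Metric.closedBall_mem_nhds x hr) (hM.mem_nhds hx),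
    inter_subset_right, C, fun t ht => LipschitzOnWith.of_dist_le_mul fun y hy z hz => ?_⟩
  simpa [h.map_zero] using H (fun s => φ s y) (fun s => φ s z) (fun t => h.hasDerivAt t y hy.2)
    (fun t => h.hasDerivAt t z hz.2) (by simpa [h.map_zero] using hy.1)
    (by simpa [h.map_zero] using hz.1) t ht

/-- Continuity in time at a fixed point combines with a Lipschitz constant in space that is uniform
over compact time intervals. -/
theorem continuousOn_uncurry (h : IsCompleteFlow M X φ) (hM : IsOpen M)
    (hX : LocallyLipschitzOn M X) : ContinuousOn (fun z : ℝ × E => φ z.1 z.2) (univ ×ˢ M) := by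
  rintro ⟨t₀, x₀⟩ ⟨-, hx₀⟩
  have hx₀ : x₀ ∈ M := hx₀
  obtain ⟨U, hU, -, C, hC⟩ := h.exists_dist_le hM hX hx₀ (|t₀| + 1)
  apply ContinuousAt.continuousWithinAt
  have h1 : Tendsto (fun z : ℝ × E => C * dist z.2 x₀ + dist (φ z.1 x₀) (φ t₀ x₀)) (𝓝 (t₀, x₀))
      (𝓝 0) := by
    have hc : Continuous (fun z : ℝ × E => C * dist z.2 x₀ + dist (φ z.1 x₀) (φ t₀ x₀)) := by
      have := (h.continuous_time x₀).comp (continuous_fst (X := ℝ) (Y := E))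
      simp only [Function.comp_def] at this
      exact (continuous_const.mul (continuous_snd.dist continuous_const)).add
        (this.dist continuous_const)
    simpa using hc.tendsto (t₀, x₀)
  rw [ContinuousAt, tendsto_iff_dist_tendsto_zero]
  refine squeeze_zero' (Eventually.of_forall fun _ => dist_nonneg) ?_ h1
  have e1 : ∀ᶠ z : ℝ × E in 𝓝 (t₀, x₀), z.2 ∈ U := continuous_snd.continuousAt.eventually hU
  have e2 : ∀ᶠ z : ℝ × E in 𝓝 (t₀, x₀), |z.1| < |t₀| + 1 :=
    (continuous_abs.comp continuous_fst).continuousAt.eventually_lt continuousAt_const (by simp)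
  filter_upwards [e1, e2] with z hz1 hz2
  refine (dist_triangle _ (φ z.1 x₀) _).trans ?_
  gcongr
  exact (hC z.1 hz2.le).dist_le_mul _ hz1 _ (mem_of_mem_nhds hU)

theorem continuousOn (h : IsCompleteFlow M X φ) (hM : IsOpen M)
    (hX : LocallyLipschitzOn M X) (t : ℝ) : ContinuousOn (φ t) M :=
  (h.continuousOn_uncurry hM hX).comp (f := fun x => (t, x)) (by fun_prop) fun x hx => ⟨trivial, hx⟩

theorem isCompact_image (h : IsCompleteFlow M X φ) (hM : IsOpen M)
    (hX : LocallyLipschitzOn M X) {K : Set E} (hK : IsCompact K) (hKM : K ⊆ M) (a b : ℝ) :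
    IsCompact ((fun z : ℝ × E => φ z.1 z.2) '' (Icc a b ×ˢ K)) :=
  (isCompact_Icc.prod hK).image_of_continuousOn
    ((h.continuousOn_uncurry hM hX).mono (prod_mono (subset_univ _) hKM))

theorem isOpen_preimage (h : IsCompleteFlow M X φ) (hM : IsOpen M)
    (hX : LocallyLipschitzOn M X) (t : ℝ) {U : Set E} (hU : IsOpen U) (hUM : U ⊆ M) :
    IsOpen (φ t ⁻¹' U) := by
  have := (h.continuousOn hM hX t).isOpen_inter_preimage hM hU
  rwa [inter_eq_self_of_subset_right] at this
  exact fun x hx => h.map_mem_iff.1 (hUM hx)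

end IsCompleteFlow

end Flow

/-! ### Liouville's theorem for divergence free fields, without differentiating the flow in space.
-/

section Liouville

/-- Near the support, compactness gives a constant `L`; a point of the support and one outside the
1-thickening are at distance at least 1, so there the sup bound serves as Lipschitz constant. -/
theorem LocallyLipschitz.exists_lipschitzWith_of_hasCompactSupport {E : Type*} [PseudoMetricSpace E]
    [ProperSpace E] {g : E → ℝ} (hg : LocallyLipschitz g) (hc : HasCompactSupport g) :
    ∃ C, LipschitzWith C g := by
  have hK : IsCompact (tsupport g) := hc
  obtain ⟨L, hL⟩ := (hg.locallyLipschitzOn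
    (s := Metric.cthickening 1 (tsupport g))).exists_lipschitzOnWith_of_compact hK.cthickening
  obtain ⟨B, hB⟩ := hc.exists_bound_of_continuous hg.continuous
  have hB0 : ∀ x y : E, 0 ≤ (|B| + L) * dist x y := fun x y => by positivity
  have key : ∀ x ∈ tsupport g, ∀ y, dist (g x) (g y) ≤ (|B| + L) * dist x y := by
    intro x hx y
    have hx' : x ∈ Metric.cthickening 1 (tsupport g) :=
      Metric.self_subset_cthickening _ hx
    by_cases hy : y ∈ Metric.cthickening 1 (tsupport g)
    · refine (hL.dist_le_mul x hx' y hy).trans ?_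
      gcongr
      exact le_add_of_nonneg_left (abs_nonneg B)
    · have hy0 : g y = 0 := image_eq_zero_of_notMem_tsupport fun h =>
        hy (Metric.self_subset_cthickening _ h)
      have h1 : 1 ≤ dist x y := by
        by_contra! hlt
        exact hy (Metric.mem_cthickening_of_dist_le y x _ _ hx (by rw [dist_comm]; exact hlt.le))
      rw [hy0, dist_zero_right]
      calc ‖g x‖ ≤ B := hB x
        _ ≤ (|B| + L) * 1 := by
          rw [mul_one]; exact (le_abs_self B).trans (le_add_of_nonneg_right L.2)
        _ ≤ _ := by gcongr
  refine ⟨⟨|B| + L, by positivity⟩, LipschitzWith.of_dist_le_mul fun x y => ?_⟩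
  change _ ≤ (|B| + L) * dist x y
  by_cases hx : x ∈ tsupport g
  · exact key x hx y
  by_cases hy : y ∈ tsupport g
  · rw [dist_comm, dist_comm x]; exact key y hy x
  · simpa [image_eq_zero_of_notMem_tsupport hx, image_eq_zero_of_notMem_tsupport hy] using hB0 x y

theorem ContDiffOn.locallyLipschitzOn_of_isOpen {E F : Type*} [NormedAddCommGroup E]
    [NormedSpace ℝ E] [NormedAddCommGroup F] [NormedSpace ℝ F] {M : Set E} {u : E → F}
    (hu : ContDiffOn ℝ 1 u M) (hM : IsOpen M) : LocallyLipschitzOn M u := by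
  intro x hx
  obtain ⟨K, t, ht, h⟩ := (hu.contDiffAt (hM.mem_nhds hx)).exists_lipschitzOnWith
  exact ⟨K, t, mem_nhdsWithin_of_mem_nhds ht, h⟩

variable {E : Type*} [NormedAddCommGroup E] [NormedSpace ℝ E] [FiniteDimensional ℝ E]
  [MeasurableSpace E] [BorelSpace E] {μ : Measure E} [μ.IsAddHaarMeasure]
  {M : Set E} {X : E → E} {φ : ℝ → E → E}

/-- Integration by parts for a Lipschitz function with compact support in `M` and a function that
is differentiable on `M` only. -/
theorem integral_fderiv_mul_eq_neg (hM : IsOpen M) {u g : E → ℝ} (hu : ContDiffOn ℝ 1 u M)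
    {C : NNReal} (hg : LipschitzWith C g) (hgc : HasCompactSupport g) (hgM : tsupport g ⊆ M)
    (v : E) :
    Integrable (fun x => fderiv ℝ g x v * u x) μ ∧
      ∫ x, fderiv ℝ g x v * u x ∂μ = -∫ x, g x * fderiv ℝ u x v ∂μ := by
  have : ProperSpace E := FiniteDimensional.proper ℝ E
  have hK : IsCompact (tsupport g) := hgc
  obtain ⟨δ, hδ, hδM⟩ := hK.exists_cthickening_subset_open hM hgM
  obtain ⟨L, hL⟩ := ((hu.locallyLipschitzOn_of_isOpen hM).mono
    hδM).exists_lipschitzOnWith_of_compact hK.cthickening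
  -- `u` is controlled only on `M`; a global Lipschitz extension `w` of its restriction near the
  -- support of `g` allows integration by parts on the whole space.
  obtain ⟨w, hw, hwu⟩ := hL.extend_real
  have hev : ∀ x ∈ tsupport g, w =ᶠ[𝓝 x] u := fun x hx => by
    filter_upwards [Metric.isOpen_thickening.mem_nhds (Metric.self_subset_thickening hδ _ hx)]
      with y hy
    exact (hwu (Metric.thickening_subset_cthickening _ _ hy)).symm
  have hf0 : ∀ x ∉ tsupport g, fderiv ℝ g x = 0 := fun x hx => by
    by_contra h
    exact hx (support_fderiv_subset ℝ h)
  have e1 : (fun x => lineDeriv ℝ g x v * w x) =ᵐ[μ] fun x => fderiv ℝ g x v * u x := by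
    filter_upwards [hg.ae_differentiableAt (μ := μ)] with x hx
    rw [hx.lineDeriv_eq_fderiv]
    by_cases hxs : x ∈ tsupport g
    · rw [(hev x hxs).eq_of_nhds]
    · simp [hf0 x hxs]
  have e2 : ∀ x, lineDeriv ℝ w x v * g x = g x * fderiv ℝ u x v := by
    intro x
    by_cases hxs : x ∈ tsupport g
    · have hd : DifferentiableAt ℝ w x := ((hu.contDiffAt (hM.mem_nhds (hgM hxs))).differentiableAt
        one_ne_zero).congr_of_eventuallyEq (hev x hxs)
      rw [hd.lineDeriv_eq_fderiv, (hev x hxs).fderiv_eq, mul_comm]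
    · simp [image_eq_zero_of_notMem_tsupport hxs]
  have hint : Integrable (fun x => fderiv ℝ g x v * u x) μ := by
    refine Integrable.congr ?_ e1
    have hsup : Function.support (fun x => lineDeriv ℝ g x v * w x) ⊆ tsupport g := by
      intro x hx
      by_contra hxs
      apply hx
      have : g =ᶠ[𝓝 x] fun _ => 0 := notMem_tsupport_iff_eventuallyEq.1 hxs
      have hd : DifferentiableAt ℝ g x := (differentiableAt_const 0).congr_of_eventuallyEq this
      simp [hd.lineDeriv_eq_fderiv, hf0 x hxs]
    rw [← integrableOn_iff_integrable_of_support_subset hsup]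
    have hwi : IntegrableOn w (tsupport g) μ := hw.continuous.continuousOn.integrableOn_compact hK
    exact hwi.bdd_mul (c := C * ‖v‖) (aestronglyMeasurable_lineDeriv hg.continuous _)
      (.of_forall fun x => norm_lineDeriv_le_of_lipschitz ℝ hg)
  refine ⟨hint, ?_⟩
  rw [← integral_congr_ae e1]
  simp_rw [← e2]
  rw [hw.integral_lineDeriv_mul_eq hg hgc v, ← integral_neg]
  simp only [lineDeriv_neg, neg_mul, neg_neg]

/-- `X` has divergence zero on `M` in the sense of distributions. -/
def IsDivergenceFree (μ : Measure E) (M : Set E) (X : E → E) : Prop :=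
  ∀ (g : E → ℝ) (C : NNReal), LipschitzWith C g → HasCompactSupport g → tsupport g ⊆ M →
    ∫ x, fderiv ℝ g x (X x) ∂μ = 0

namespace IsCompleteFlow

variable [ProperSpace E]

omit [FiniteDimensional ℝ E] [MeasurableSpace E] [BorelSpace E] in
-- Lipschitz functions with compact support in `M` are stable under composition with the flow. This
-- is why they are the test functions for the divergence.
theorem comp_lipschitz (h : IsCompleteFlow M X φ) (hM : IsOpen M) (hX : LocallyLipschitzOn M X)
    {f : E → ℝ} {C : NNReal} (hf : LipschitzWith C f) (hfc : HasCompactSupport f)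
    (hfM : tsupport f ⊆ M) (t : ℝ) :
    (∃ C, LipschitzWith C (fun x => f (φ t x))) ∧ HasCompactSupport (fun x => f (φ t x)) ∧
      tsupport (fun x => f (φ t x)) ⊆ M := by
  have hK : IsCompact (φ (-t) '' tsupport f) :=
    IsCompact.image_of_continuousOn hfc ((h.continuousOn hM hX _).mono hfM)
  have hKM : φ (-t) '' tsupport f ⊆ M := by
    rintro _ ⟨x, hx, rfl⟩; exact h.map_mem _ _ (hfM hx)
  have h0 : ∀ x ∉ φ (-t) '' tsupport f, f (φ t x) = 0 := fun x hx => by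
    by_contra hne
    exact hx ⟨φ t x, subset_tsupport _ hne, h.map_neg_map hM hX t x⟩
  have hs : tsupport (fun x => f (φ t x)) ⊆ φ (-t) '' tsupport f :=
    closure_minimal (fun x hx => by by_contra hc; exact hx (h0 x hc)) hK.isClosed
  have hcs : HasCompactSupport (fun x => f (φ t x)) := HasCompactSupport.intro hK h0
  refine ⟨LocallyLipschitz.exists_lipschitzWith_of_hasCompactSupport (fun x => ?_) hcs, hcs,
    hs.trans hKM⟩
  by_cases hx : x ∈ M
  · obtain ⟨U, hU, -, L, hL⟩ := h.exists_dist_le hM hX hx |t|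
    exact ⟨C * L, U, hU, (hf.lipschitzOnWith (s := univ)).comp (hL t le_rfl) (mapsTo_univ _ _)⟩
  · refine ⟨0, (φ (-t) '' tsupport f)ᶜ, hK.isClosed.isOpen_compl.mem_nhds fun h => hx (hKM h),
      fun y hy z hz => ?_⟩
    simp [h0 y hy, h0 z hz]

theorem hasDerivAt_integral_comp (h : IsCompleteFlow M X φ) (hM : IsOpen M)
    (hX : LocallyLipschitzOn M X) (hdiv : IsDivergenceFree μ M X)
    {g : E → ℝ} {C : NNReal} (hg : LipschitzWith C g) (hgc : HasCompactSupport g)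
    (hgM : tsupport g ⊆ M) :
    HasDerivAt (fun s => ∫ x, g (φ s x) ∂μ) 0 0 := by
  -- A point whose orbit meets `tsupport g` at some time in `[-1, 1]` lies in `Γ`; the orbits of
  -- points of `Γ` over `[-1, 1]` lie in the compact set `Γ2`, where `X` is bounded.
  set Γ := (fun z : ℝ × E => φ z.1 z.2) '' (Icc (-1) 1 ×ˢ tsupport g)
  have hΓ : IsCompact Γ := h.isCompact_image hM hX hgc hgM _ _
  have hΓM : Γ ⊆ M := by
    rintro _ ⟨z, hz, rfl⟩; exact h.map_mem _ _ (hgM hz.2)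
  have hΓ2 := h.isCompact_image hM hX hΓ hΓM (-1) 1
  set Γ2 := (fun z : ℝ × E => φ z.1 z.2) '' (Icc (-1) 1 ×ˢ Γ)
  have hΓ2M : Γ2 ⊆ M := by
    rintro _ ⟨z, hz, rfl⟩; exact h.map_mem _ _ (hΓM hz.2)
  obtain ⟨D, hD⟩ := hΓ2.exists_bound_of_continuousOn (hX.continuousOn.mono hΓ2M)
  have hmeas : ∀ s, Continuous (fun x => g (φ s x)) := fun s => by
    obtain ⟨⟨_, hL⟩, -⟩ := h.comp_lipschitz hM hX hg hgc hgM s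
    exact hL.continuous
  -- By Rademacher's theorem, differentiability of `g` almost everywhere suffices for the dominated
  -- derivative.
  have hdiff : ∀ᵐ x ∂μ, HasDerivAt (fun s => g (φ s x)) (fderiv ℝ g x (X x)) 0 := by
    filter_upwards [hg.ae_differentiableAt (μ := μ)] with x hx
    by_cases hxM : x ∈ M
    · have h1 := h.hasDerivAt 0 x hxM
      rw [h.map_zero] at h1
      have h2 : HasFDerivAt g (fderiv ℝ g x) (φ 0 x) := by
        rw [h.map_zero]; exact hx.hasFDerivAt
      exact h2.comp_hasDerivAt (0 : ℝ) h1
    · have hf0 : fderiv ℝ g x = 0 := by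
        by_contra hne
        exact hxM (hgM (support_fderiv_subset ℝ hne))
      simp only [h.map_notMem _ x hxM, hf0]
      exact hasDerivAt_const _ _
  have hlip : ∀ x, LipschitzOnWith (Real.nnabs (Γ.indicator (fun _ => C * D) x))
      (fun s => g (φ s x)) (Ioo (-1) 1) := by
    intro x
    by_cases hx : x ∈ Γ
    · have hD0 : 0 ≤ D := (norm_nonneg _).trans (hD x ⟨(0, x), ⟨by simp, hx⟩, h.map_zero x⟩)
      have h1 : LipschitzOnWith (NNReal.mk D hD0) (fun s => φ s x) (Ioo (-1) 1) :=
        (convex_Ioo _ _).lipschitzOnWith_of_nnnorm_hasDerivWithin_le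
          (fun s _ => (h.hasDerivAt s x (hΓM hx)).hasDerivWithinAt)
          (fun s hs => hD _ ⟨(s, x), ⟨⟨hs.1.le, hs.2.le⟩, hx⟩, rfl⟩)
      have h2 : Real.nnabs (Γ.indicator (fun _ => C * D) x) = C * (NNReal.mk D hD0) := by
        ext
        simp [hx, abs_of_nonneg hD0]
      rw [h2]
      exact (hg.lipschitzOnWith (s := univ)).comp h1 (mapsTo_univ _ _)
    · have hz : ∀ s ∈ Ioo (-1 : ℝ) 1, g (φ s x) = 0 := fun s hs => by
        by_contra hne
        exact hx ⟨(-s, φ s x), ⟨⟨by simpa using hs.2.le, by simpa using neg_le_neg hs.1.le⟩,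
          subset_tsupport _ hne⟩, h.map_neg_map hM hX s x⟩
      intro s hs r hr
      simp [hz s hs, hz r hr]
  -- `X` need not be measurable off `M`, so measurability comes from the difference quotients.
  have hF' : AEStronglyMeasurable (fun x => fderiv ℝ g x (X x)) μ := by
    refine aestronglyMeasurable_of_tendsto_ae (u := 𝓝[≠] (0 : ℝ))
      (f := fun s x => s⁻¹ • (g (φ s x) - g (φ 0 x))) (fun s => ?_) ?_
    · exact ((((hmeas s).sub (hmeas 0)).const_smul s⁻¹)).aestronglyMeasurable
    · filter_upwards [hdiff] with x hx
      simpa using hx.tendsto_slope_zero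
  have := (hasDerivAt_integral_of_dominated_loc_of_lip (s := Ioo (-1) 1) (x₀ := (0 : ℝ)) (μ := μ)
    (bound := Γ.indicator fun _ => C * D) (Ioo_mem_nhds (by simp) (by simp))
    (.of_forall fun s => (hmeas s).aestronglyMeasurable)
    (by simpa [h.map_zero] using hg.continuous.integrable_of_hasCompactSupport hgc) hF'
    (.of_forall hlip)
    ((integrable_indicator_iff hΓ.measurableSet).2 (integrableOn_const hΓ.measure_lt_top.ne))
    hdiff).2
  rwa [hdiv g C hg hgc hgM] at this

/-- By the group law, the derivative at time `t` is the derivative at time `0` for the test function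
`f ∘ φ t`. -/
theorem integral_comp (h : IsCompleteFlow M X φ) (hM : IsOpen M)
    (hX : LocallyLipschitzOn M X) (hdiv : IsDivergenceFree μ M X)
    {f : E → ℝ} {C : NNReal} (hf : LipschitzWith C f) (hfc : HasCompactSupport f)
    (hfM : tsupport f ⊆ M) (t : ℝ) : ∫ x, f (φ t x) ∂μ = ∫ x, f x ∂μ := by
  have hd : ∀ t, HasDerivAt (fun s => ∫ x, f (φ s x) ∂μ) 0 t := fun t => by
    obtain ⟨⟨L, hL⟩, hc, hM'⟩ := h.comp_lipschitz hM hX hf hfc hfM t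
    have h1 := h.hasDerivAt_integral_comp hM hX hdiv hL hc hM'
    simp only [h.map_add hM hX] at h1
    rw [← sub_self t] at h1
    simpa using h1.comp_sub_const t t
  have := is_const_of_deriv_eq_zero (fun t => (hd t).differentiableAt) (fun t => (hd t).deriv) t 0
  simpa [h.map_zero] using this

/-- Inner regularity reduces to compact `K ⊆ U`, and a Lipschitz cutoff that is 1 on `K` and
supported in `U` has the same integral after composition with the flow. -/
theorem measure_le_preimage (h : IsCompleteFlow M X φ) (hM : IsOpen M)
    (hX : LocallyLipschitzOn M X) (hdiv : IsDivergenceFree μ M X) {U : Set E} (hU : IsOpen U)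
    (hUM : U ⊆ M) (t : ℝ) : μ U ≤ μ (φ t ⁻¹' U) := by
  rw [hU.measure_eq_iSup_isCompact]
  refine iSup₂_le fun K hKU => iSup_le fun hK => ?_
  obtain ⟨δ, hδ, hδU⟩ := hK.exists_cthickening_subset_open hU hKU
  set f : E → ℝ := fun x => (thickenedIndicator hδ K x : ℝ)
  have hf : LipschitzWith _ f := (LipschitzWith.subtype_val _).comp
    (lipschitzWith_thickenedIndicator hδ K)
  have hf0 : ∀ x ∉ Metric.cthickening δ K, f x = 0 := fun x hx => by
    simp only [f, thickenedIndicator_zero hδ K fun h =>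
      hx (Metric.thickening_subset_cthickening _ _ h), NNReal.coe_zero]
  have hfc : HasCompactSupport f := HasCompactSupport.intro hK.cthickening hf0
  have hfs : tsupport f ⊆ U := (closure_minimal
    (fun x hx => by by_contra hc; exact hx (hf0 x hc)) Metric.isClosed_cthickening).trans hδU
  have hfi : Integrable f μ := hf.continuous.integrable_of_hasCompactSupport hfc
  obtain ⟨⟨L, hL⟩, hgc, -⟩ := h.comp_lipschitz hM hX hf hfc (hfs.trans hUM) t
  have hgi := hL.continuous.integrable_of_hasCompactSupport hgc (μ := μ)
  have hU' := (h.isOpen_preimage hM hX t hU hUM).measurableSet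
  have hnn : ∀ x, 0 ≤ f x := fun x => NNReal.coe_nonneg _
  have hle : ∀ x, f x ≤ 1 := fun x => by exact_mod_cast thickenedIndicator_le_one hδ K x
  calc μ K = ∫⁻ x, K.indicator 1 x ∂μ := by rw [lintegral_indicator_one hK.measurableSet]
    _ ≤ ∫⁻ x, ENNReal.ofReal (f x) ∂μ := by
      refine lintegral_mono fun x => ?_
      by_cases hx : x ∈ K
      · simp only [hx, indicator_of_mem, Pi.one_apply, f, thickenedIndicator_one hδ K hx,
          NNReal.coe_one, ENNReal.ofReal_one, le_refl]
      · simp [hx]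
    _ = ENNReal.ofReal (∫ x, f x ∂μ) := (ofReal_integral_eq_lintegral_ofReal hfi (.of_forall hnn)).symm
    _ = ENNReal.ofReal (∫ x, f (φ t x) ∂μ) := by
      rw [h.integral_comp hM hX hdiv hf hfc (hfs.trans hUM) t]
    _ = ∫⁻ x, ENNReal.ofReal (f (φ t x)) ∂μ :=
      ofReal_integral_eq_lintegral_ofReal hgi (.of_forall fun x => hnn _)
    _ ≤ ∫⁻ x, (φ t ⁻¹' U).indicator 1 x ∂μ := by
      refine lintegral_mono fun x => ?_
      by_cases hx : φ t x ∈ U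
      · simpa [mem_preimage.2 hx] using hle (φ t x)
      · have : f (φ t x) = 0 := image_eq_zero_of_notMem_tsupport fun hc => hx (hfs hc)
        simp [this]
    _ = μ (φ t ⁻¹' U) := lintegral_indicator_one hU'

omit [FiniteDimensional ℝ E] in
theorem measurable (h : IsCompleteFlow M X φ) (hM : IsOpen M) (hX : LocallyLipschitzOn M X)
    (t : ℝ) : Measurable (φ t) := by
  refine measurable_of_restrict_of_restrict_compl hM.measurableSet ?_ ?_
  · exact (continuousOn_iff_continuous_domRestrict.1 (h.continuousOn hM hX t)).measurable
  · have : Mᶜ.domRestrict (φ t) = Subtype.val := funext fun x => h.map_notMem t x x.2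
    rw [this]
    exact measurable_subtype_coe

/-- **Liouville's theorem**: the complete flow of a divergence free vector field preserves
the Haar measure. -/
theorem measurePreserving (h : IsCompleteFlow M X φ) (hM : IsOpen M)
    (hX : LocallyLipschitzOn M X) (hdiv : IsDivergenceFree μ M X) (t : ℝ) :
    MeasurePreserving (φ t) (μ.restrict M) (μ.restrict M) := by
  refine ⟨h.measurable hM hX t, ?_⟩
  have heq : ∀ U, IsOpen U → μ.restrict M (φ t ⁻¹' U) = μ.restrict M U := by
    intro U hU
    have h1 : φ t ⁻¹' U ∩ M = φ t ⁻¹' (U ∩ M) := by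
      ext x; simp [h.map_mem_iff]
    rw [Measure.restrict_apply (h.measurable hM hX t hU.measurableSet),
      Measure.restrict_apply hU.measurableSet, h1]
    have hUM : IsOpen (U ∩ M) := hU.inter hM
    -- The reverse inequality is the same one for the open set `φ t ⁻¹' (U ∩ M)` at time `-t`.
    refine le_antisymm ?_ (h.measure_le_preimage hM hX hdiv hUM inter_subset_right t)
    refine (h.measure_le_preimage hM hX hdiv (h.isOpen_preimage hM hX t hUM inter_subset_right)
      (fun x hx => h.map_mem_iff.1 hx.2) (-t)).trans ?_
    rw [← preimage_comp]
    have : φ t ∘ φ (-t) = id := funext fun x => h.map_map_neg hM hX t x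
    simp [this]
  symm
  refine Measure.ext_of_generateFrom_of_iUnion {s | IsOpen s} (fun n : ℕ => Metric.ball (0 : E) n)
    (BorelSpace.measurable_eq) isPiSystem_isOpen (Metric.iUnion_ball_nat _)
    (fun _ => Metric.isOpen_ball) (fun n => ?_) (fun U hU => ?_)
  · exact ((Measure.restrict_apply_le _ _).trans_lt Metric.isBounded_ball.measure_lt_top).ne
  · rw [Measure.map_apply (h.measurable hM hX t) (IsOpen.measurableSet hU), heq U hU]

end IsCompleteFlow

end Liouville

/-! ### Poisson brackets, Hamiltonian fields and Liouville's equation. -/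

section Hamiltonian

variable {n : ℕ} {M : Set (PhaseSpace n)} {H : PhaseSpace n → ℝ}

instance PhaseSpace.isAddHaarMeasure_volume :
    (volume : Measure (PhaseSpace n)).IsAddHaarMeasure :=
  Measure.prod.instIsAddHaarMeasure _ _

theorem PhaseSpace.eq_sum (y : PhaseSpace n) :
    y = ∑ i, (y.1 i • ((Pi.single i 1, 0) : PhaseSpace n) + y.2 i • (0, Pi.single i 1)) := by
  ext j <;> simp [Prod.fst_sum, Prod.snd_sum, Finset.sum_apply, Pi.single_apply]

theorem PhaseSpace.map_hamiltonianVectorField (L : PhaseSpace n →L[ℝ] ℝ) (x : PhaseSpace n) :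
    L (hamiltonianVectorField H x) =
      ∑ i, (L (0, Pi.single i 1) * partialP H i x - L (Pi.single i 1, 0) * partialQ H i x) := by
  conv_lhs => rw [PhaseSpace.eq_sum (hamiltonianVectorField H x)]
  simp only [hamiltonianVectorField, map_sum, map_add, map_smul, smul_eq_mul]
  refine Finset.sum_congr rfl fun i _ => by ring

theorem fderiv_hamiltonianVectorField (f : PhaseSpace n → ℝ) (x : PhaseSpace n) :
    fderiv ℝ f x (hamiltonianVectorField H x) = poissonBracket f H x :=
  PhaseSpace.map_hamiltonianVectorField _ _

theorem poissonBracket_antisymm (f g : PhaseSpace n → ℝ) (x : PhaseSpace n) :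
    poissonBracket f g x = -poissonBracket g f x := by
  simp only [poissonBracket, ← Finset.sum_neg_distrib]
  exact Finset.sum_congr rfl fun i _ => by ring

theorem poissonBracket_self (f : PhaseSpace n → ℝ) (x : PhaseSpace n) :
    poissonBracket f f x = 0 := by
  linarith [poissonBracket_antisymm f f x]

theorem poissonBracket_sub_const_mul {f H A : PhaseSpace n → ℝ} {x : PhaseSpace n}
    (hH : DifferentiableAt ℝ H x) (hA : DifferentiableAt ℝ A x) (h : ℝ) :
    poissonBracket f (fun y => H y - h * A y) x = poissonBracket f H x - h * poissonBracket f A x := by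
  simp only [poissonBracket, partialP, partialQ, Finset.mul_sum, ← Finset.sum_sub_distrib]
  rw [fderiv_fun_sub hH (hA.const_mul h), fderiv_const_mul hA]
  refine Finset.sum_congr rfl fun i _ => ?_
  simp only [sub_apply, smul_apply, smul_eq_mul]
  ring

theorem contDiffOn_fderiv_apply {E : Type*} [NormedAddCommGroup E] [NormedSpace ℝ E] {M : Set E}
    (hM : IsOpen M) {f : E → ℝ} (hf : ContDiffOn ℝ 2 f M) (v : E) :
    ContDiffOn ℝ 1 (fun x => fderiv ℝ f x v) M :=
  (hf.fderiv_of_isOpen hM (by norm_num)).clm_apply contDiffOn_const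

theorem contDiffOn_poissonBracket (hM : IsOpen M) {f g : PhaseSpace n → ℝ}
    (hf : ContDiffOn ℝ 2 f M) (hg : ContDiffOn ℝ 2 g M) :
    ContDiffOn ℝ 1 (poissonBracket f g) M := by
  unfold poissonBracket
  exact ContDiffOn.sum fun i _ =>
    ((contDiffOn_fderiv_apply hM hf _).mul (contDiffOn_fderiv_apply hM hg _)).sub
      ((contDiffOn_fderiv_apply hM hf _).mul (contDiffOn_fderiv_apply hM hg _))

theorem contDiffOn_hamiltonianVectorField (hM : IsOpen M) (hH : ContDiffOn ℝ 2 H M) :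
    ContDiffOn ℝ 1 (hamiltonianVectorField H) M := by
  unfold hamiltonianVectorField
  exact (contDiffOn_pi.2 fun i => (contDiffOn_fderiv_apply hM hH _).neg).prodMk
    (contDiffOn_pi.2 fun i => contDiffOn_fderiv_apply hM hH _)

theorem continuousOn_poissonBracket (hM : IsOpen M) {f g : PhaseSpace n → ℝ}
    (hf : ContDiffOn ℝ 1 f M) (hg : ContDiffOn ℝ 1 g M) :
    ContinuousOn (poissonBracket f g) M := by
  have h : ∀ {f : PhaseSpace n → ℝ}, ContDiffOn ℝ 1 f M → ∀ v, ContinuousOn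
      (fun x => fderiv ℝ f x v) M := fun hf v =>
    (hf.continuousOn_fderiv_of_isOpen hM le_rfl).clm_apply continuousOn_const
  unfold poissonBracket
  exact continuousOn_finsetSum _ fun i _ => ((h hf _).mul (h hg _)).sub ((h hf _).mul (h hg _))

/-- After integration by parts, the terms `∂²H/∂q_i∂p_i` and `∂²H/∂p_i∂q_i` cancel by symmetry of
second derivatives. -/
theorem isDivergenceFree_hamiltonianVectorField (hM : IsOpen M) (hH : ContDiffOn ℝ 2 H M) :
    IsDivergenceFree volume M (hamiltonianVectorField H) := by
  intro g C hg hgc hgM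
  have key := fun v w : PhaseSpace n => integral_fderiv_mul_eq_neg (μ := volume) hM
    (contDiffOn_fderiv_apply hM hH w) hg hgc hgM v
  have hsymm : ∀ v w : PhaseSpace n, ∫ x, g x * fderiv ℝ (fun y => fderiv ℝ H y w) x v =
      ∫ x, g x * fderiv ℝ (fun y => fderiv ℝ H y v) x w := by
    intro v w
    refine integral_congr_ae (.of_forall fun x => ?_)
    by_cases hx : x ∈ tsupport g
    · have hxM := hM.mem_nhds (hgM hx)
      have hd : DifferentiableAt ℝ (fderiv ℝ H) x :=
        ((hH.fderiv_of_isOpen hM (m := 1) (by norm_num)).contDiffAt hxM).differentiableAt one_ne_zero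
      have h1 : ∀ v w : PhaseSpace n, fderiv ℝ (fun y => fderiv ℝ H y w) x v =
          fderiv ℝ (fderiv ℝ H) x v w := fun v w => by
        rw [fderiv_clm_apply hd (differentiableAt_const w)]
        simp
      have hs := (hH.contDiffAt hxM).isSymmSndFDerivAt (by simp) v w
      simp only [h1, hs]
    · simp [image_eq_zero_of_notMem_tsupport hx]
  simp_rw [PhaseSpace.map_hamiltonianVectorField]
  unfold partialP partialQ
  rw [integral_finsetSum _ fun i _ => by exact (key _ _).1.sub (key _ _).1]
  refine Finset.sum_eq_zero fun i _ => ?_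
  rw [integral_sub (key _ _).1 (key _ _).1, (key _ _).2, (key _ _).2, hsymm, sub_self]

variable {φ : ℝ → PhaseSpace n → PhaseSpace n}

/-- Along the flow of `H`, the derivative of an observable is its Poisson bracket with `H`. -/
theorem IsCompleteFlow.hasDerivAt_comp (h : IsCompleteFlow M (hamiltonianVectorField H) φ)
    {f : PhaseSpace n → ℝ} {x : PhaseSpace n} (hx : x ∈ M) (t : ℝ)
    (hf : DifferentiableAt ℝ f (φ t x)) :
    HasDerivAt (fun s => f (φ s x)) (poissonBracket f H (φ t x)) t := by
  rw [← fderiv_hamiltonianVectorField]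
  exact hf.hasFDerivAt.comp_hasDerivAt t (h.hasDerivAt t x hx)

theorem IsCompleteFlow.energy_eq (h : IsCompleteFlow M (hamiltonianVectorField H) φ)
    (hH : ∀ x ∈ M, DifferentiableAt ℝ H x) {x : PhaseSpace n} (hx : x ∈ M) (t : ℝ) :
    H (φ t x) = H x := by
  have hd : ∀ s, HasDerivAt (fun s => H (φ s x)) 0 s := fun s => by
    simpa [poissonBracket_self] using h.hasDerivAt_comp hx s (hH _ (h.map_mem s x hx))
  have := is_const_of_deriv_eq_zero (fun s => (hd s).differentiableAt) (fun s => (hd s).deriv) t 0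
  simpa [h.map_zero] using this

/-- A classical solution of Liouville's equation is constant along the motions. -/
theorem IsLiouvilleSolution.eq_comp {ρ₀ : PhaseSpace n → ℝ} {ρ : ℝ → PhaseSpace n → ℝ}
    (hρ : IsLiouvilleSolution M H ρ₀ ρ) (hM : IsOpen M)
    (h : IsCompleteFlow M (hamiltonianVectorField H) φ) {x : PhaseSpace n} (hx : x ∈ M) {t : ℝ}
    (ht : 0 ≤ t) : ρ t (φ t x) = ρ₀ x := by
  rcases ht.eq_or_lt with rfl | ht
  · rw [h.map_zero, hρ.initial x hx]
  have hd : ∀ s, 0 < s → HasDerivAt (fun s => ρ s (φ s x)) 0 s := by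
    intro s hs
    have hy := h.map_mem s x hx
    have hG : DifferentiableAt ℝ (fun z : ℝ × PhaseSpace n => ρ z.1 z.2) (s, φ s x) :=
      (hρ.contDiffOn.contDiffAt ((isOpen_Ioi.prod hM).mem_nhds ⟨mem_Ioi.2 hs, hy⟩)).differentiableAt
        one_ne_zero
    set L := fderiv ℝ (fun z : ℝ × PhaseSpace n => ρ z.1 z.2) (s, φ s x)
    have h1 : HasDerivAt (fun r => ρ r (φ s x)) (L (1, 0)) s :=
      hG.hasFDerivAt.comp_hasDerivAt (f := fun r => (r, φ s x)) s
        ((hasDerivAt_id s).prodMk (hasDerivAt_const s _))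
    have h2 : HasFDerivAt (ρ s) (L.comp (ContinuousLinearMap.inr ℝ ℝ (PhaseSpace n))) (φ s x) :=
      hG.hasFDerivAt.comp (f := fun y => (s, y)) (φ s x) (hasFDerivAt_prodMk_right s _)
    have h3 : L (0, hamiltonianVectorField H (φ s x)) = poissonBracket (ρ s) H (φ s x) := by
      rw [← fderiv_hamiltonianVectorField, h2.fderiv]
      simp
    have h4 := hG.hasFDerivAt.comp_hasDerivAt (f := fun r => (r, φ r x)) s
        ((hasDerivAt_id s).prodMk (h.hasDerivAt s x hx))
    -- The total derivative along the motion is `∂ρ/∂t + [ρ, H] = [H, ρ] + [ρ, H] = 0`.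
    have h5 : L (1, hamiltonianVectorField H (φ s x)) = 0 := by
      have : ((1, hamiltonianVectorField H (φ s x)) : ℝ × PhaseSpace n) =
        (1, 0) + (0, hamiltonianVectorField H (φ s x)) := by simp
      rw [this, map_add, h3, h1.unique (hρ.equation s hs _ hy), poissonBracket_antisymm,
        neg_add_cancel]
    rw [← h5]
    exact h4
  -- At time `0` the solution is only continuous, so the mean value theorem is used on `[0, t]` with
  -- derivatives in the interior.
  have hc : ContinuousOn (fun s => ρ s (φ s x)) (Icc 0 t) :=
    hρ.continuousOn.comp (f := fun s => (s, φ s x))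
      (continuous_id.prodMk (h.continuous_time x)).continuousOn
      fun s hs => ⟨hs.1, h.map_mem s x hx⟩
  obtain ⟨c, -, hc⟩ := exists_hasDerivAt_eq_slope _ _ ht hc fun s hs => hd s hs.1
  have : ρ t (φ t x) - ρ 0 (φ 0 x) = 0 := by
    rw [sub_zero, eq_comm, div_eq_zero_iff] at hc
    exact hc.resolve_right ht.ne'
  rw [h.map_zero, hρ.initial x hx] at this
  linarith

end Hamiltonian

/-! ### Measure-theoretic estimates: almost invariance and autocorrelation. -/

section Estimates

/-- Cauchy–Schwarz, read off from the nonnegative integral of `(f - m) ^ 2` with `m` the mean of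
`f`. -/
theorem sq_intervalIntegral_le {f : ℝ → ℝ} (hf : Continuous f) {r s : ℝ} (hrs : r ≤ s) :
    (∫ u in r..s, f u) ^ 2 ≤ (s - r) * ∫ u in r..s, f u ^ 2 := by
  rcases hrs.eq_or_lt with rfl | hlt
  · simp
  set I := ∫ u in r..s, f u
  have hd : 0 < s - r := sub_pos.2 hlt
  set m := I / (s - r)
  have h0 : 0 ≤ ∫ u in r..s, (f u - m) ^ 2 :=
    intervalIntegral.integral_nonneg hrs fun u _ => sq_nonneg _
  have h1 : ∫ u in r..s, (f u - m) ^ 2 = (∫ u in r..s, f u ^ 2) - 2 * m * I + (s - r) * m ^ 2 := by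
    have h : ∀ u, (f u - m) ^ 2 = f u ^ 2 - 2 * m * f u + m ^ 2 := fun u => by ring
    simp_rw [h]
    rw [intervalIntegral.integral_add, intervalIntegral.integral_sub,
      intervalIntegral.integral_const_mul, intervalIntegral.integral_const, smul_eq_mul]
    all_goals exact Continuous.intervalIntegrable (by fun_prop) _ _
  have h2 : m * (s - r) = I := div_mul_cancel₀ _ hd.ne'
  have h3 : (s - r) * ((∫ u in r..s, f u ^ 2) - 2 * m * I + (s - r) * m ^ 2) =
      (s - r) * (∫ u in r..s, f u ^ 2) - I ^ 2 := by
    rw [← h2]; ring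
  have h4 := mul_nonneg hd.le (h0.trans_eq h1)
  rw [h3] at h4
  linarith

variable {Ω : Type*} [MeasurableSpace Ω]

theorem integrable_prod_of_forall_integral_abs_le {ν : Measure ℝ} [IsFiniteMeasure ν]
    {μ : Measure Ω} [SFinite μ] {k : ℝ × Ω → ℝ} (hk : AEStronglyMeasurable k (ν.prod μ)) {D : ℝ}
    (hint : ∀ s, Integrable (fun x => k (s, x)) μ) (hD : ∀ s, ∫ x, |k (s, x)| ∂μ ≤ D) :
    Integrable k (ν.prod μ) := by
  refine (integrable_prod_iff hk).2 ⟨.of_forall hint, ?_⟩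
  refine Integrable.mono' (integrable_const D) hk.norm.integral_prod_right' (.of_forall fun s => ?_)
  rw [Real.norm_of_nonneg (integral_nonneg fun _ => norm_nonneg _)]
  exact hD s

theorem Integrable.mul_of_sq {μ : Measure Ω} {f g : Ω → ℝ} (hf : AEStronglyMeasurable f μ)
    (hg : AEStronglyMeasurable g μ) (hf2 : Integrable (fun x => f x ^ 2) μ)
    (hg2 : Integrable (fun x => g x ^ 2) μ) : Integrable (fun x => f x * g x) μ :=
  ((memLp_two_iff_integrable_sq hf).2 hf2).integrable_mul ((memLp_two_iff_integrable_sq hg).2 hg2)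

/-- The weighted form of Cauchy–Schwarz. It is applied with `θ` equal to `ε`, to `|s - r|` and to
`1`, which avoids square roots. -/
theorem abs_integral_mul_le {μ : Measure Ω} {f g : Ω → ℝ}
    (hf2 : Integrable (fun x => f x ^ 2) μ)
    (hg2 : Integrable (fun x => g x ^ 2) μ) {θ : ℝ} (hθ : 0 < θ) :
    |∫ x, f x * g x ∂μ| ≤ 1 / 2 * (θ * ∫ x, f x ^ 2 ∂μ + θ⁻¹ * ∫ x, g x ^ 2 ∂μ) := by
  rw [← integral_const_mul, ← integral_const_mul,
    ← integral_add (hf2.const_mul _) (hg2.const_mul _), ← integral_const_mul]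
  refine (abs_integral_le_integral_abs).trans (integral_mono_of_nonneg
    (.of_forall fun _ => abs_nonneg _) (((hf2.const_mul _).add (hg2.const_mul _)).const_mul _)
    (.of_forall fun x => ?_))
  have h1 : θ * f x ^ 2 + θ⁻¹ * g x ^ 2 = θ⁻¹ * ((θ * f x) ^ 2 + g x ^ 2) := by
    field_simp
  have h2 : |f x * g x| = θ⁻¹ * |(θ * f x) * g x| := by
    rw [mul_assoc, abs_mul θ, abs_of_pos hθ, inv_mul_cancel_left₀ hθ.ne']
  simp only
  rw [h1, h2, mul_left_comm]
  gcongr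
  rw [abs_le]
  constructor <;> nlinarith [sq_nonneg (θ * f x + g x), sq_nonneg (θ * f x - g x)]

/-- If the image of `μ` under `T` has a density close to `1` in `L²`, then the mean of `F ∘ T` is
close to the mean of `F`. -/
theorem integral_comp_sub_integral_le {μ : Measure Ω} [IsProbabilityMeasure μ] {T : Ω → Ω}
    (hT : Measurable T) {w : Ω → ℝ} (hw : AEMeasurable w μ) (hw0 : ∀ x, 0 ≤ w x)
    (hmap : μ.map T = μ.withDensity fun x => ENNReal.ofReal (w x))
    (hw2 : Integrable (fun x => w x ^ 2) μ) {ε : ℝ} (hε : 0 < ε)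
    (hwε : ∫ x, w x ^ 2 ∂μ ≤ 1 + ε ^ 2) {F : Ω → ℝ} (hF : AEStronglyMeasurable F μ)
    (hF2 : Integrable (fun x => F x ^ 2) μ) :
    Integrable (fun x => F (T x)) μ ∧
      |∫ x, F (T x) ∂μ - ∫ x, F x ∂μ| ≤ ε / 2 * (∫ x, F x ^ 2 ∂μ + 1) := by
  have hFm : AEStronglyMeasurable F (μ.map T) := by
    rw [hmap]; exact hF.mono_ac (withDensity_absolutelyContinuous _ _)
  have hwi : Integrable w μ := ((memLp_two_iff_integrable_sq hw.aestronglyMeasurable).2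
    hw2).integrable (by norm_num)
  have hFi : Integrable F μ := ((memLp_two_iff_integrable_sq hF).2 hF2).integrable (by norm_num)
  have hw1 : ∫ x, w x ∂μ = 1 := by
    have : IsProbabilityMeasure (μ.map T) := Measure.isProbabilityMeasure_map hT.aemeasurable
    have h1 : μ.map T univ = 1 := measure_univ
    rw [hmap, withDensity_apply _ MeasurableSet.univ, Measure.restrict_univ] at h1
    rw [integral_eq_lintegral_of_nonneg_ae (.of_forall hw0) hw.aestronglyMeasurable, h1]
    rfl
  have hwF : Integrable (fun x => w x * F x) μ := Integrable.mul_of_sq hw.aestronglyMeasurable hF hw2 hF2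
  have hFT : Integrable (fun x => F (T x)) μ := by
    refine (integrable_map_measure hFm hT.aemeasurable).1 ?_
    rw [hmap]
    refine (integrable_withDensity_iff_integrable_smul₀ (f := fun x => (w x).toNNReal)
      hw.real_toNNReal).2 (hwF.congr (.of_forall fun x => ?_))
    simp [NNReal.smul_def, Real.coe_toNNReal _ (hw0 x)]
  refine ⟨hFT, ?_⟩
  have h1 : ∫ x, F (T x) ∂μ = ∫ x, w x * F x ∂μ := by
    rw [← integral_map hT.aemeasurable hFm, hmap]
    refine (integral_withDensity_eq_integral_smul₀ (f := fun x => (w x).toNNReal)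
      hw.real_toNNReal F).trans (integral_congr_ae (.of_forall fun x => ?_))
    simp [NNReal.smul_def, Real.coe_toNNReal _ (hw0 x)]
  have hexp : ∀ x, (w x - 1) ^ 2 = w x ^ 2 - 2 * w x + 1 := fun x => by ring
  have h3 : Integrable (fun x => (w x - 1) ^ 2) μ := by
    simp_rw [hexp]
    exact (hw2.sub (hwi.const_mul 2)).add (integrable_const 1)
  -- Since `w` has mean 1, its squared distance from 1 is its second moment minus 1.
  have h4 : ∫ x, (w x - 1) ^ 2 ∂μ ≤ ε ^ 2 := by
    simp_rw [hexp]
    rw [integral_add (by exact hw2.sub (hwi.const_mul 2)) (integrable_const 1),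
      integral_sub hw2 (hwi.const_mul 2), integral_const_mul, hw1]
    simp
    linarith
  have h5 : ∫ x, F (T x) ∂μ - ∫ x, F x ∂μ = ∫ x, F x * (w x - 1) ∂μ := by
    rw [h1, ← integral_sub hwF hFi]
    exact integral_congr_ae (.of_forall fun x => by ring)
  rw [h5]
  refine (abs_integral_mul_le hF2 h3
    hε).trans ?_
  have h6 : ε⁻¹ * ∫ x, (w x - 1) ^ 2 ∂μ ≤ ε := by
    calc _ ≤ ε⁻¹ * ε ^ 2 := by gcongr
      _ = ε := by field_simp
  linarith

/-- A measure with density transforms under a measure preserving bijection with inverse `ψ`. -/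
theorem map_withDensity_eq {lam : Measure Ω} {φ ψ : Ω → Ω} (hφ : MeasurePreserving φ lam lam)
    (hφe : MeasurableEmbedding φ) (hψφ : ∀ x, ψ (φ x) = x)
    {ρ w : Ω → ℝ} (hρ : AEMeasurable ρ lam) (hρ0 : ∀ x, 0 ≤ ρ x) (hw : AEMeasurable w lam)
    (h : ∀ᵐ x ∂lam, ρ (ψ x) = ρ x * w x) :
    (lam.withDensity fun x => ENNReal.ofReal (ρ x)).map φ =
      (lam.withDensity fun x => ENNReal.ofReal (ρ x)).withDensity fun x => ENNReal.ofReal (w x) := by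
  rw [← withDensity_mul₀ hρ.ennreal_ofReal hw.ennreal_ofReal]
  ext S hS
  rw [Measure.map_apply hφ.measurable hS, withDensity_apply _ (hφ.measurable hS),
    withDensity_apply _ hS, ← hφ.setLIntegral_comp_preimage_emb hφe _ S]
  refine lintegral_congr_ae (ae_restrict_of_ae ?_)
  filter_upwards [hφ.quasiMeasurePreserving.ae h] with x hx
  rw [hψφ] at hx
  rw [Pi.mul_apply, ← ENNReal.ofReal_mul (hρ0 _), ← hx]

/-- The second moment of the relative density of the image of a Gibbs measure. -/
theorem integral_sq_exp_le {lam : Measure Ω} {T : Ω → Ω} (hT : MeasurePreserving T lam lam)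
    (hTe : MeasurableEmbedding T) {ρ A : Ω → ℝ} {c : ℝ} (hρ : AEMeasurable ρ lam)
    (hρ0 : ∀ x, 0 ≤ ρ x) (hA : AEMeasurable A lam)
    (h : ∀ᵐ x ∂lam, ρ (T x) = ρ x * Real.exp (-c * (A (T x) - A x)))
    (h₁ : Integrable (fun x => ρ x * Real.exp (3 * c * A x)) lam)
    (h₂ : Integrable (fun x => ρ x * Real.exp (-(3 * c * A x))) lam) :
    Integrable (fun x => ρ x * Real.exp (-c * (A (T x) - A x)) ^ 2) lam ∧
      ∫ x, ρ x * Real.exp (-c * (A (T x) - A x)) ^ 2 ∂lam ≤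
        1 / 2 * (∫ x, ρ x * Real.exp (3 * c * A x) ∂lam +
          ∫ x, ρ x * Real.exp (-(3 * c * A x)) ∂lam) := by
  have h₂T : Integrable (fun x => ρ (T x) * Real.exp (-(3 * c * A (T x)))) lam :=
    (hT.integrable_comp_emb hTe).2 h₂
  have hle : ∀ᵐ x ∂lam, ρ x * Real.exp (-c * (A (T x) - A x)) ^ 2 ≤
      1 / 2 * (ρ x * Real.exp (3 * c * A x) + ρ (T x) * Real.exp (-(3 * c * A (T x)))) := by
    filter_upwards [h] with x hx
    -- The halved exponents turn the bound into `a² (a² - b⁴)² ≥ 0`. The term `a² b⁸` is chosen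
    -- because `ρ x * (a² b⁸)` is a function of `T x` alone, so invariance of `lam` removes `T`.
    set a := Real.exp (c * A x / 2)
    set b := Real.exp (-(c * A (T x)) / 2)
    have e1 : Real.exp (-c * (A (T x) - A x)) ^ 2 = a ^ 4 * b ^ 4 := by
      simp only [a, b, ← Real.exp_nat_mul, ← Real.exp_add]
      congr 1; push_cast; ring
    have e2 : Real.exp (3 * c * A x) = a ^ 6 := by
      simp only [a, ← Real.exp_nat_mul]
      congr 1; push_cast; ring
    have e3 : ρ (T x) * Real.exp (-(3 * c * A (T x))) = ρ x * (a ^ 2 * b ^ 8) := by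
      rw [hx, mul_assoc]
      simp only [a, b, ← Real.exp_nat_mul, ← Real.exp_add]
      congr 2; push_cast; ring
    rw [e1, e2, e3]
    have : a ^ 4 * b ^ 4 ≤ 1 / 2 * (a ^ 6 + a ^ 2 * b ^ 8) := by
      nlinarith [mul_nonneg (sq_nonneg a) (sq_nonneg (a ^ 2 - b ^ 4))]
    calc _ ≤ ρ x * (1 / 2 * (a ^ 6 + a ^ 2 * b ^ 8)) := by gcongr; exact hρ0 x
      _ = _ := by ring
  have hAT : AEMeasurable (fun x => A (T x)) lam := hA.comp_quasiMeasurePreserving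
    hT.quasiMeasurePreserving
  have hi := (h₁.add h₂T).const_mul (1 / 2)
  have hint : Integrable (fun x => ρ x * Real.exp (-c * (A (T x) - A x)) ^ 2) lam := by
    refine hi.mono' (AEMeasurable.aestronglyMeasurable ?_) ?_
    · exact hρ.mul ((Real.measurable_exp.comp_aemeasurable
        ((hAT.sub hA).const_mul (-c))).pow_const 2)
    · filter_upwards [hle] with x hx
      rw [Real.norm_of_nonneg (mul_nonneg (hρ0 x) (sq_nonneg _))]
      exact hx
  refine ⟨hint, (integral_mono_ae hint hi hle).trans_eq ?_⟩
  rw [integral_const_mul]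
  simp only [Pi.add_apply]
  rw [integral_add h₁ h₂T, hT.integral_comp hTe fun x => ρ x * Real.exp (-(3 * c * A x))]

variable {μ : Measure Ω} {φ : ℝ → Ω → Ω} {b g : Ω → ℝ} {κ : ℝ}

/-- The increment of `b` is the time integral of `g`; Cauchy–Schwarz in time gives one factor `s -
r`, and Fubini with the uniform bound `κ` gives the other. -/
theorem integral_sq_sub_le [SFinite μ]
    (hjoint : AEStronglyMeasurable (fun z : ℝ × Ω => g (φ z.1 z.2)) (volume.prod μ))
    (hcont : ∀ᵐ x ∂μ, Continuous fun s => g (φ s x))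
    (hftc : ∀ᵐ x ∂μ, ∀ r s, b (φ s x) - b (φ r x) = ∫ u in r..s, g (φ u x))
    (hg : ∀ s, Integrable (fun x => g (φ s x) ^ 2) μ) (hκ : ∀ s, ∫ x, g (φ s x) ^ 2 ∂μ ≤ κ)
    (r s : ℝ) : ∫ x, (b (φ s x) - b (φ r x)) ^ 2 ∂μ ≤ (s - r) ^ 2 * κ := by
  wlog hrs : r ≤ s generalizing r s
  · have := this s r (le_of_not_ge hrs)
    simpa only [← neg_sub (b (φ s _)) (b (φ r _)), ← neg_sub s r, neg_sq] using this
  have hprod : Integrable (fun z : ℝ × Ω => g (φ z.1 z.2) ^ 2)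
      ((volume.restrict (Ioc r s)).prod μ) := by
    refine integrable_prod_of_forall_integral_abs_le (D := κ) ?_ hg fun u => ?_
    · refine AEStronglyMeasurable.pow (hjoint.mono_measure ?_) 2
      exact Measure.prod_mono Measure.restrict_le_self le_rfl
    · simpa only [abs_of_nonneg (sq_nonneg (g _))] using hκ u
  have hsw : ∫ x, (∫ u in r..s, g (φ u x) ^ 2) ∂μ = ∫ u in r..s, (∫ x, g (φ u x) ^ 2 ∂μ) := by
    simp only [intervalIntegral.integral_of_le hrs]
    exact (integral_integral_swap (f := fun u x => g (φ u x) ^ 2) hprod).symm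
  have hint : Integrable (fun x => ∫ u in r..s, g (φ u x) ^ 2) μ := by
    simp only [intervalIntegral.integral_of_le hrs]
    exact hprod.integral_prod_right
  have hint2 : IntervalIntegrable (fun u => ∫ x, g (φ u x) ^ 2 ∂μ) volume r s :=
    (intervalIntegrable_iff_integrableOn_Ioc_of_le hrs).2 hprod.integral_prod_left
  calc ∫ x, (b (φ s x) - b (φ r x)) ^ 2 ∂μ
      ≤ ∫ x, ((s - r) * ∫ u in r..s, g (φ u x) ^ 2) ∂μ := by
        refine integral_mono_of_nonneg (.of_forall fun _ => sq_nonneg _) (hint.const_mul _) ?_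
        filter_upwards [hcont, hftc] with x hx hx'
        simp only [hx' r s]
        exact sq_intervalIntegral_le hx hrs
    _ = (s - r) * ∫ u in r..s, (∫ x, g (φ u x) ^ 2 ∂μ) := by rw [integral_const_mul, hsw]
    _ ≤ (s - r) * ∫ _ in r..s, κ := by
        gcongr
        exact intervalIntegral.integral_mono_on hrs hint2 intervalIntegrable_const fun u _ => hκ u
    _ = (s - r) ^ 2 * κ := by simp; ring

/-- The autocorrelation function `∫ b (b ∘ φ t)` is Lipschitz. -/
theorem abs_integral_mul_sub_le
    (hsub : ∀ r s, ∫ x, (b (φ s x) - b (φ r x)) ^ 2 ∂μ ≤ (s - r) ^ 2 * κ)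
    (hb : AEStronglyMeasurable b μ) (hb2 : Integrable (fun x => b x ^ 2) μ)
    (hbφ : ∀ s, AEStronglyMeasurable (fun x => b (φ s x)) μ)
    (hbφ2 : ∀ s, Integrable (fun x => b (φ s x) ^ 2) μ) (r s : ℝ) :
    |∫ x, b x * b (φ s x) ∂μ - ∫ x, b x * b (φ r x) ∂μ| ≤
      1 / 2 * (∫ x, b x ^ 2 ∂μ + κ) * |s - r| := by
  rcases eq_or_ne s r with rfl | hne
  · simp
  have hpos : 0 < |s - r| := abs_pos.2 (sub_ne_zero.2 hne)
  have hi := fun s => Integrable.mul_of_sq hb (hbφ s) hb2 (hbφ2 s)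
  rw [← integral_sub (hi s) (hi r)]
  simp_rw [← mul_sub]
  have hd2 : Integrable (fun x => (b (φ s x) - b (φ r x)) ^ 2) μ :=
    (((memLp_two_iff_integrable_sq (hbφ s)).2 (hbφ2 s)).sub
      ((memLp_two_iff_integrable_sq (hbφ r)).2 (hbφ2 r))).integrable_sq
  refine (abs_integral_mul_le hb2 hd2 hpos).trans ?_
  have : |s - r|⁻¹ * ∫ x, (b (φ s x) - b (φ r x)) ^ 2 ∂μ ≤ |s - r| * κ := by
    calc _ ≤ |s - r|⁻¹ * ((s - r) ^ 2 * κ) := by gcongr; exact hsub r s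
      _ = |s - r| * κ := by rw [← sq_abs]; field_simp
  linarith

/-- Polarization: `2 b (b ∘ φ t) = b² + (b ∘ φ t)² - (b ∘ φ t - b)²`. -/
theorem le_integral_mul_comp (h0 : ∀ x, φ 0 x = x)
    (hsub : ∀ r s, ∫ x, (b (φ s x) - b (φ r x)) ^ 2 ∂μ ≤ (s - r) ^ 2 * κ)
    (hb : AEStronglyMeasurable b μ) (hb2 : Integrable (fun x => b x ^ 2) μ)
    (hbφ : ∀ s, AEStronglyMeasurable (fun x => b (φ s x)) μ)
    (hbφ2 : ∀ s, Integrable (fun x => b (φ s x) ^ 2) μ) (t : ℝ) :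
    1 / 2 * (∫ x, b x ^ 2 ∂μ + ∫ x, b (φ t x) ^ 2 ∂μ - t ^ 2 * κ) ≤ ∫ x, b x * b (φ t x) ∂μ := by
  have hi := Integrable.mul_of_sq hb (hbφ t) hb2 (hbφ2 t)
  have h1 := hsub 0 t
  have h2 : ∀ x, (b (φ t x) - b (φ 0 x)) ^ 2 = b x ^ 2 + b (φ t x) ^ 2 - 2 * (b x * b (φ t x)) :=
    fun x => by rw [h0]; ring
  simp_rw [h2] at h1
  rw [integral_sub (by exact hb2.add (hbφ2 t)) (hi.const_mul 2), integral_add hb2 (hbφ2 t),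
    integral_const_mul, sub_zero] at h1
  linarith

end Estimates

/-! ### The Gibbs measure under the perturbed flow. -/

section Gibbs

theorem IsCompleteFlow.measurableEmbedding {E : Type*} [NormedAddCommGroup E] [NormedSpace ℝ E]
    [ProperSpace E] [MeasurableSpace E] [BorelSpace E] {M : Set E} {X : E → E} {φ : ℝ → E → E}
    (h : IsCompleteFlow M X φ) (hM : IsOpen M) (hX : LocallyLipschitzOn M X) (t : ℝ) :
    MeasurableEmbedding (φ t) :=
  MeasurableEquiv.measurableEmbedding
    { toFun := φ t
      invFun := φ (-t)
      left_inv := h.map_neg_map hM hX t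
      right_inv := h.map_map_neg hM hX t
      measurable_toFun := h.measurable hM hX t
      measurable_invFun := h.measurable hM hX (-t) }

theorem ContinuousOn.aestronglyMeasurable_prod {E : Type*} [NormedAddCommGroup E]
    [SecondCountableTopology E] [MeasurableSpace E] [BorelSpace E] {M : Set E}
    (hM : IsOpen M) {k : ℝ × E → ℝ} (hk : ContinuousOn k (univ ×ˢ M)) {ν : Measure ℝ} [SFinite ν]
    {μ : Measure E} [SFinite μ] (hμ : ∀ᵐ x ∂μ, x ∈ M) : AEStronglyMeasurable k (ν.prod μ) := by
  have : ν.prod μ = (ν.prod μ).restrict (univ ×ˢ M) := by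
    rw [← Measure.prod_restrict, Measure.restrict_univ, Measure.restrict_eq_self_of_ae_mem hμ]
  rw [this]
  exact hk.aestronglyMeasurable (MeasurableSet.univ.prod hM.measurableSet)

variable {n : ℕ} {M : Set (PhaseSpace n)} {β : ℝ} {H₀ : PhaseSpace n → ℝ}

theorem gibbsDensity_pos (hM : IsOpen M) (hne : M.Nonempty)
    (hZ : IntegrableOn (fun x => Real.exp (-β * H₀ x)) M) (x : PhaseSpace n) :
    0 < gibbsDensity M β H₀ x := by
  refine div_pos (Real.exp_pos _) ?_
  refine (setIntegral_pos_iff_support_of_nonneg_ae (.of_forall fun _ => (Real.exp_pos _).le) hZ).2 ?_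
  have : Function.support (fun x => Real.exp (-β * H₀ x)) = univ :=
    eq_univ_of_forall fun x => (Real.exp_pos _).ne'
  rw [this, univ_inter]
  exact hM.measure_pos _ hne

theorem gibbsDensity_nonneg (x : PhaseSpace n) : 0 ≤ gibbsDensity M β H₀ x :=
  div_nonneg (Real.exp_pos _).le (integral_nonneg fun _ => (Real.exp_pos _).le)

theorem continuousOn_gibbsDensity (hH₀ : ContinuousOn H₀ M) :
    ContinuousOn (gibbsDensity M β H₀) M :=
  (Real.continuous_exp.comp_continuousOn (continuousOn_const.mul hH₀)).div_const _

theorem aemeasurable_gibbsDensity (hM : IsOpen M) (hH₀ : ContinuousOn H₀ M) :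
    AEMeasurable (gibbsDensity M β H₀) (volume.restrict M) :=
  (continuousOn_gibbsDensity hH₀).aemeasurable hM.measurableSet

theorem gibbsMeasure_absolutelyContinuous : gibbsMeasure M β H₀ ≪ volume.restrict M :=
  withDensity_absolutelyContinuous _ _

theorem ae_gibbsMeasure_mem (hM : IsOpen M) : ∀ᵐ x ∂gibbsMeasure M β H₀, x ∈ M :=
  gibbsMeasure_absolutelyContinuous.ae_le (ae_restrict_mem hM.measurableSet)

theorem aestronglyMeasurable_gibbsMeasure (hM : IsOpen M) {f : PhaseSpace n → ℝ}
    (hf : ContinuousOn f M) : AEStronglyMeasurable f (gibbsMeasure M β H₀) :=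
  (hf.aestronglyMeasurable hM.measurableSet).mono_ac gibbsMeasure_absolutelyContinuous

theorem integral_gibbsMeasure (hM : IsOpen M) (hH₀ : ContinuousOn H₀ M) (f : PhaseSpace n → ℝ) :
    ∫ x, f x ∂gibbsMeasure M β H₀ = ∫ x in M, gibbsDensity M β H₀ x * f x := by
  refine (integral_withDensity_eq_integral_smul₀
    (f := fun x => (gibbsDensity M β H₀ x).toNNReal)
    (aemeasurable_gibbsDensity hM hH₀).real_toNNReal f).trans
    (integral_congr_ae (.of_forall fun x => ?_))
  simp [NNReal.smul_def, Real.coe_toNNReal _ (gibbsDensity_nonneg x)]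

theorem integrable_gibbsMeasure (hM : IsOpen M) (hH₀ : ContinuousOn H₀ M) {f : PhaseSpace n → ℝ} :
    Integrable f (gibbsMeasure M β H₀) ↔
      IntegrableOn (fun x => gibbsDensity M β H₀ x * f x) M := by
  refine (integrable_withDensity_iff_integrable_smul₀
    (f := fun x => (gibbsDensity M β H₀ x).toNNReal)
    (aemeasurable_gibbsDensity hM hH₀).real_toNNReal).trans
    (integrable_congr (.of_forall fun x => ?_))
  simp [NNReal.smul_def, Real.coe_toNNReal _ (gibbsDensity_nonneg x)]

theorem isProbabilityMeasure_gibbsMeasure (hM : IsOpen M) (hne : M.Nonempty)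
    (hZ : IntegrableOn (fun x => Real.exp (-β * H₀ x)) M) :
    IsProbabilityMeasure (gibbsMeasure M β H₀) := by
  refine ⟨?_⟩
  rw [gibbsMeasure, withDensity_apply _ MeasurableSet.univ, Measure.restrict_univ,
    ← ofReal_integral_eq_lintegral_ofReal (show Integrable (gibbsDensity M β H₀)
      (volume.restrict M) from hZ.div_const _) (.of_forall gibbsDensity_nonneg)]
  have hZ0 : (∫ y in M, Real.exp (-β * H₀ y)) ≠ 0 := fun h0 => by
    have := gibbsDensity_pos hM hne hZ 0
    rw [gibbsDensity, h0, div_zero] at this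
    exact this.false
  unfold gibbsDensity
  rw [integral_div, div_self hZ0, ENNReal.ofReal_one]

variable {A : PhaseSpace n → ℝ} {h : ℝ} {φ : ℝ → PhaseSpace n → PhaseSpace n}

theorem contDiffOn_sub_const_mul (hH₀ : ContDiffOn ℝ 2 H₀ M) (hA : ContDiffOn ℝ 2 A M) :
    ContDiffOn ℝ 2 (fun x => H₀ x - h * A x) M :=
  hH₀.sub (contDiffOn_const.mul hA)

theorem locallyLipschitzOn_hamiltonianVectorField (hM : IsOpen M) {H : PhaseSpace n → ℝ}
    (hH : ContDiffOn ℝ 2 H M) : LocallyLipschitzOn M (hamiltonianVectorField H) :=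
  (contDiffOn_hamiltonianVectorField hM hH).locallyLipschitzOn_of_isOpen hM

/-- Liouville's theorem for a Hamiltonian flow. -/
theorem IsCompleteFlow.measurePreserving_hamiltonian (hM : IsOpen M) {H : PhaseSpace n → ℝ}
    (hH : ContDiffOn ℝ 2 H M) (hφ : IsCompleteFlow M (hamiltonianVectorField H) φ) (t : ℝ) :
    MeasurePreserving (φ t) (volume.restrict M) (volume.restrict M) :=
  hφ.measurePreserving hM (locallyLipschitzOn_hamiltonianVectorField hM hH)
    (isDivergenceFree_hamiltonianVectorField hM hH) t

/-- Conservation of `H₀ - h * A` makes `H₀` change by exactly `h` times the change of `A`. -/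
theorem gibbsDensity_comp (hM : IsOpen M) (hH₀ : ContDiffOn ℝ 2 H₀ M) (hA : ContDiffOn ℝ 2 A M)
    (hφ : IsCompleteFlow M (hamiltonianVectorField fun x => H₀ x - h * A x) φ)
    {x : PhaseSpace n} (hx : x ∈ M) (t : ℝ) :
    gibbsDensity M β H₀ (φ t x) =
      gibbsDensity M β H₀ x * Real.exp (-(β * h) * (A (φ t x) - A x)) := by
  have hE := hφ.energy_eq (fun x hx => ((contDiffOn_sub_const_mul hH₀ hA).contDiffAt
    (hM.mem_nhds hx)).differentiableAt two_ne_zero) hx t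
  have : H₀ (φ t x) = H₀ x + h * (A (φ t x) - A x) := by linarith
  unfold gibbsDensity
  rw [this, div_mul_eq_mul_div, ← Real.exp_add]
  congr 2
  ring

/-- For a weak perturbation, means in the Gibbs state are almost invariant under the perturbed
flow, uniformly in time. -/
theorem gibbsMeasure_integral_comp (hM : IsOpen M) (hH₀ : ContDiffOn ℝ 2 H₀ M)
    (hA : ContDiffOn ℝ 2 A M) [IsProbabilityMeasure (gibbsMeasure M β H₀)]
    (hφ : IsCompleteFlow M (hamiltonianVectorField fun x => H₀ x - h * A x) φ)
    (h₁ : Integrable (fun x => Real.exp (3 * (β * h) * A x)) (gibbsMeasure M β H₀))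
    (h₂ : Integrable (fun x => Real.exp (-(3 * (β * h) * A x))) (gibbsMeasure M β H₀))
    {ε : ℝ} (hε : 0 < ε)
    (hle : 1 / 2 * (∫ x, Real.exp (3 * (β * h) * A x) ∂gibbsMeasure M β H₀ +
      ∫ x, Real.exp (-(3 * (β * h) * A x)) ∂gibbsMeasure M β H₀) ≤ 1 + ε ^ 2)
    {F : PhaseSpace n → ℝ} (hF : AEStronglyMeasurable F (gibbsMeasure M β H₀))
    (hF2 : Integrable (fun x => F x ^ 2) (gibbsMeasure M β H₀)) (s : ℝ) :
    Integrable (fun x => F (φ s x)) (gibbsMeasure M β H₀) ∧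
      |∫ x, F (φ s x) ∂gibbsMeasure M β H₀ - ∫ x, F x ∂gibbsMeasure M β H₀| ≤
        ε / 2 * (∫ x, F x ^ 2 ∂gibbsMeasure M β H₀ + 1) := by
  have hX := locallyLipschitzOn_hamiltonianVectorField hM (contDiffOn_sub_const_mul (h := h) hH₀ hA)
  have hP := hφ.measurePreserving_hamiltonian hM (contDiffOn_sub_const_mul hH₀ hA)
  have hEmb := hφ.measurableEmbedding hM hX
  have hρm := aemeasurable_gibbsDensity (β := β) hM hH₀.continuousOn
  have hAm : AEMeasurable A (volume.restrict M) := hA.continuousOn.aemeasurable hM.measurableSet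
  have hq : ∀ᵐ x ∂volume.restrict M, gibbsDensity M β H₀ (φ (-s) x) =
      gibbsDensity M β H₀ x * Real.exp (-(β * h) * (A (φ (-s) x) - A x)) := by
    filter_upwards [ae_restrict_mem hM.measurableSet] with x hx
    exact gibbsDensity_comp hM hH₀ hA hφ hx (-s)
  have hwm : AEMeasurable (fun x => Real.exp (-(β * h) * (A (φ (-s) x) - A x)))
      (volume.restrict M) :=
    Real.measurable_exp.comp_aemeasurable
      (((hAm.comp_quasiMeasurePreserving (hP (-s)).quasiMeasurePreserving).sub hAm).const_mul _)
  -- The relative density of the image under `φ s` involves the inverse map, hence the time `-s`.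
  obtain ⟨hi, hb⟩ := integral_sq_exp_le (hP (-s)) (hEmb (-s)) hρm gibbsDensity_nonneg hAm hq
    ((integrable_gibbsMeasure hM hH₀.continuousOn).1 h₁)
    ((integrable_gibbsMeasure hM hH₀.continuousOn).1 h₂)
  rw [← integral_gibbsMeasure hM hH₀.continuousOn, ← integral_gibbsMeasure hM hH₀.continuousOn,
    ← integral_gibbsMeasure hM hH₀.continuousOn] at hb
  exact integral_comp_sub_integral_le (hφ.measurable hM hX s)
    (hwm.mono_ac gibbsMeasure_absolutelyContinuous) (fun x => (Real.exp_pos _).le)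
    (map_withDensity_eq (hP s) (hEmb s) (hφ.map_neg_map hM hX s) hρm gibbsDensity_nonneg hwm hq)
    ((integrable_gibbsMeasure hM hH₀.continuousOn).2 hi) hε (hb.trans hle) hF hF2

variable {B : PhaseSpace n → ℝ} {ρ : ℝ → PhaseSpace n → ℝ}

theorem IsLiouvilleSolution.eq_comp_neg {H ρ₀ : PhaseSpace n → ℝ}
    (hρ : IsLiouvilleSolution M H ρ₀ ρ) (hM : IsOpen M) (hH : ContDiffOn ℝ 2 H M)
    (hφ : IsCompleteFlow M (hamiltonianVectorField H) φ) {x : PhaseSpace n} (hx : x ∈ M) {t : ℝ}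
    (ht : 0 ≤ t) : ρ t x = ρ₀ (φ (-t) x) := by
  rw [← hρ.eq_comp hM hφ (hφ.map_mem (-t) x hx) ht,
    hφ.map_map_neg hM (locallyLipschitzOn_hamiltonianVectorField hM hH)]

/-- Along the perturbed flow `H₀` has derivative `[H₀, H₀ - h A] = h [A, H₀]`; running backwards and
the factor `-β` in the exponent give the sign. -/
theorem hasDerivAt_gibbsDensity_comp_neg (hM : IsOpen M) (hH₀ : ContDiffOn ℝ 2 H₀ M)
    (hA : ContDiffOn ℝ 2 A M)
    (hφ : IsCompleteFlow M (hamiltonianVectorField fun x => H₀ x - h * A x) φ)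
    {x : PhaseSpace n} (hx : x ∈ M) (s : ℝ) :
    HasDerivAt (fun s => gibbsDensity M β H₀ (φ (-s) x))
      (β * h * (poissonBracket A H₀ (φ (-s) x) * gibbsDensity M β H₀ (φ (-s) x))) s := by
  have hy := hM.mem_nhds (hφ.map_mem (-s) x hx)
  have hdH : DifferentiableAt ℝ H₀ (φ (-s) x) := (hH₀.contDiffAt hy).differentiableAt two_ne_zero
  have hdA : DifferentiableAt ℝ A (φ (-s) x) := (hA.contDiffAt hy).differentiableAt two_ne_zero
  have h1 := hφ.hasDerivAt_comp hx (-s) hdH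
  rw [poissonBracket_sub_const_mul hdH hdA, poissonBracket_self, poissonBracket_antisymm H₀ A] at h1
  have h2 := h1.scomp s (hasDerivAt_neg s)
  have h3 := ((h2.const_mul (-β)).exp).div_const (∫ y in M, Real.exp (-β * H₀ y))
  refine HasDerivAt.congr_deriv (f := fun s => gibbsDensity M β H₀ (φ (-s) x)) h3 ?_
  simp only [gibbsDensity, Function.comp_apply, smul_eq_mul]
  ring

theorem integrableOn_mul_liouville (hM : IsOpen M) (hH₀ : ContDiffOn ℝ 2 H₀ M)
    (hA : ContDiffOn ℝ 2 A M)
    (hφ : IsCompleteFlow M (hamiltonianVectorField fun x => H₀ x - h * A x) φ)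
    (hρ : IsLiouvilleSolution M (fun x => H₀ x - h * A x) (gibbsDensity M β H₀) ρ)
    {t : ℝ} (ht : 0 ≤ t) (hB : Integrable (fun x => B (φ t x)) (gibbsMeasure M β H₀)) :
    IntegrableOn (fun x => B x * ρ t x) M := by
  have hH := contDiffOn_sub_const_mul (h := h) hH₀ hA
  have hX := locallyLipschitzOn_hamiltonianVectorField hM hH
  have h1 := (integrable_gibbsMeasure hM hH₀.continuousOn).1 hB
  have h2 : IntegrableOn (fun x => gibbsDensity M β H₀ (φ (-t) x) * B x) M := by
    refine ((hφ.measurePreserving_hamiltonian hM hH t).integrable_comp_emb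
      (hφ.measurableEmbedding hM hX t)).1 (h1.congr (.of_forall fun x => ?_))
    simp [hφ.map_neg_map hM hX]
  refine h2.congr ?_
  filter_upwards [ae_restrict_mem hM.measurableSet] with x hx
  rw [hρ.eq_comp_neg hM hH hφ hx ht, mul_comm]

/-- The increment of `⟨B⟩` is the time integral of the autocorrelation function of `B`. -/
theorem deltaMean_eq (hM : IsOpen M) (hH₀ : ContDiffOn ℝ 2 H₀ M)
    (hA : ContDiffOn ℝ 2 A M) [IsProbabilityMeasure (gibbsMeasure M β H₀)]
    (hφ : IsCompleteFlow M (hamiltonianVectorField fun x => H₀ x - h * A x) φ)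
    (hρ : IsLiouvilleSolution M (fun x => H₀ x - h * A x) (gibbsDensity M β H₀) ρ)
    (hBdef : B = poissonBracket A H₀)
    (hB : ∀ s, Integrable (fun x => B (φ s x)) (gibbsMeasure M β H₀))
    (hBB : ∀ s, Integrable (fun x => B x * B (φ s x)) (gibbsMeasure M β H₀)) {D : ℝ}
    (hD : ∀ s, ∫ x, |B x * B (φ s x)| ∂gibbsMeasure M β H₀ ≤ D) {t : ℝ} (ht : 0 ≤ t) :
    deltaMean M B ρ t =
      β * h * ∫ s in 0..t, (∫ x, B x * B (φ s x) ∂gibbsMeasure M β H₀) := by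
  have hH := contDiffOn_sub_const_mul (h := h) hH₀ hA
  have hX := locallyLipschitzOn_hamiltonianVectorField hM hH
  have hP := hφ.measurePreserving_hamiltonian hM hH
  have hEmb := hφ.measurableEmbedding hM hX
  have hBc : ContinuousOn B M := hBdef ▸ (contDiffOn_poissonBracket hM hA hH₀).continuousOn
  -- Up to the factor `β h`, this is the time derivative of `B x * ρ s x`; substituting `φ s x` for
  -- `x` turns its integral into the autocorrelation of `B`.
  set k : ℝ → PhaseSpace n → ℝ :=
    fun s x => B x * (B (φ (-s) x) * gibbsDensity M β H₀ (φ (-s) x)) with hk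
  have hkφ : ∀ s x, k s (φ s x) = gibbsDensity M β H₀ x * (B x * B (φ s x)) := fun s x => by
    simp only [hk, hφ.map_neg_map hM hX]; ring
  have hki : ∀ s, IntegrableOn (k s) M := fun s => by
    refine ((hP s).integrable_comp_emb (hEmb s)).1
      (((integrable_gibbsMeasure hM hH₀.continuousOn).1 (hBB s)).congr (.of_forall fun x => ?_))
    exact (hkφ s x).symm
  have hkint : ∀ s, ∫ x in M, k s x = ∫ x, B x * B (φ s x) ∂gibbsMeasure M β H₀ := fun s => by
    rw [integral_gibbsMeasure hM hH₀.continuousOn, ← (hP s).integral_comp (hEmb s)]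
    simp only [hkφ]
  have hkabs : ∀ s, ∫ x in M, |k s x| ≤ D := fun s => by
    refine le_trans (le_of_eq ?_) (hD s)
    rw [integral_gibbsMeasure hM hH₀.continuousOn,
      ← (hP s).integral_comp (hEmb s) (fun x => |k s x|)]
    simp only [hkφ, abs_mul, abs_of_nonneg (gibbsDensity_nonneg _)]
  have hflow : ContinuousOn (fun z : ℝ × PhaseSpace n => φ (-z.1) z.2) (univ ×ˢ M) :=
    (hφ.continuousOn_uncurry hM hX).comp (f := fun z : ℝ × PhaseSpace n => (-z.1, z.2))
      (by fun_prop) fun z hz => ⟨trivial, hz.2⟩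
  have hmaps : MapsTo (fun z : ℝ × PhaseSpace n => φ (-z.1) z.2) (univ ×ˢ M) M :=
    fun z hz => hφ.map_mem _ _ hz.2
  have hkc : ContinuousOn (fun z : ℝ × PhaseSpace n => k z.1 z.2) (univ ×ˢ M) :=
    (hBc.comp continuousOn_snd fun z hz => hz.2).mul ((hBc.comp hflow hmaps).mul
      ((continuousOn_gibbsDensity hH₀.continuousOn).comp hflow hmaps))
  have hprod : Integrable (fun z : ℝ × PhaseSpace n => k z.1 z.2)
      ((volume.restrict (Ioc 0 t)).prod (volume.restrict M)) :=
    integrable_prod_of_forall_integral_abs_le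
      (hkc.aestronglyMeasurable_prod hM (ae_restrict_mem hM.measurableSet)) hki hkabs
  have hint := fun {s : ℝ} (hs : 0 ≤ s) => integrableOn_mul_liouville hM hH₀ hA hφ hρ hs (hB s)
  have hpt : ∀ x ∈ M, B x * ρ t x - B x * ρ 0 x = β * h * ∫ s in 0..t, k s x := by
    intro x hx
    have hkx : Continuous fun s => k s x := by
      refine continuousOn_univ.1 ?_
      exact hkc.comp (f := fun s => (s, x)) (by fun_prop) fun s _ => ⟨trivial, hx⟩
    have hd : ∀ s, HasDerivAt (fun s => B x * gibbsDensity M β H₀ (φ (-s) x)) (β * h * k s x) s :=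
      fun s => by
        refine ((hasDerivAt_gibbsDensity_comp_neg hM hH₀ hA hφ hx s).const_mul (B x)).congr_deriv ?_
        rw [hk, ← hBdef]; ring
    rw [← intervalIntegral.integral_const_mul, intervalIntegral.integral_eq_sub_of_hasDerivAt
      (fun s _ => hd s) ((continuous_const.mul hkx).intervalIntegrable _ _),
      hρ.eq_comp_neg hM hH hφ hx ht, hρ.eq_comp_neg hM hH hφ hx le_rfl]
  rw [deltaMean, ← integral_sub (hint ht) (hint le_rfl),
    setIntegral_congr_fun hM.measurableSet hpt, integral_const_mul]
  simp only [intervalIntegral.integral_of_le ht]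
  rw [← integral_integral_swap (f := k) hprod]
  simp only [hkint]

end Gibbs

/-! ### Lower bounds for the relaxation time at fixed `h`. -/

section RelaxationTime

variable {n : ℕ} {M : Set (PhaseSpace n)} {β : ℝ} {H₀ A B : PhaseSpace n → ℝ} {h : ℝ}
  {φ : ℝ → PhaseSpace n → PhaseSpace n} {ρ : ℝ → PhaseSpace n → ℝ}

theorem le_relaxationTime {T : ℝ} (h0 : IntegrableOn (fun x => B x * ρ 0 x) M)
    (h : ∀ t, 0 < t → t < T → IntegrableOn (fun x => B x * ρ t x) M ∧
      ∃ d, 0 ≤ d ∧ HasDerivAt (deltaMean M B ρ) d t) : (T : EReal) ≤ relaxationTime M B ρ := by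
  refine le_sSup ⟨T, ⟨h0, fun t ht htT => ?_⟩, rfl⟩
  obtain ⟨hi, d, hd, hD⟩ := h t ht htT
  exact ⟨hi, hD.differentiableAt, by rwa [hD.deriv]⟩

/-- A lower bound for the relaxation time for a fixed strength `h` of the perturbation. The number
`ε` measures how far the Gibbs state is from being invariant under the perturbed flow. -/
theorem le_relaxationTime_of_forall_sq_mul_le (hM : IsOpen M) (hβ : 0 < β)
    (hH₀ : ContDiffOn ℝ 2 H₀ M) (hA : ContDiffOn ℝ 2 A M)
    [IsProbabilityMeasure (gibbsMeasure M β H₀)]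
    (hh : 0 < h) (hh1 : h ≤ 1)
    (hφ : IsCompleteFlow M (hamiltonianVectorField fun x => H₀ x - h * A x) φ)
    (hρ : IsLiouvilleSolution M (fun x => H₀ x - h * A x) (gibbsDensity M β H₀) ρ)
    (hBdef : B = poissonBracket A H₀)
    (h₁ : Integrable (fun x => Real.exp (3 * (β * h) * A x)) (gibbsMeasure M β H₀))
    (h₂ : Integrable (fun x => Real.exp (-(3 * (β * h) * A x))) (gibbsMeasure M β H₀))
    {ε : ℝ} (hε : 0 < ε)
    (hle : 1 / 2 * (∫ x, Real.exp (3 * (β * h) * A x) ∂gibbsMeasure M β H₀ +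
      ∫ x, Real.exp (-(3 * (β * h) * A x)) ∂gibbsMeasure M β H₀) ≤ 1 + ε ^ 2)
    (hB4 : Integrable (fun x => (B x ^ 2) ^ 2) (gibbsMeasure M β H₀))
    (hP2 : Integrable (fun x => poissonBracket B H₀ x ^ 2) (gibbsMeasure M β H₀))
    (hP4 : Integrable (fun x => (poissonBracket B H₀ x ^ 2) ^ 2) (gibbsMeasure M β H₀))
    (hQ2 : Integrable (fun x => poissonBracket B A x ^ 2) (gibbsMeasure M β H₀))
    (hQ4 : Integrable (fun x => (poissonBracket B A x ^ 2) ^ 2) (gibbsMeasure M β H₀))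
    {T : ℝ} (hT : ∀ t, 0 < t → t < T →
      t ^ 2 * ((1 + h) * ∫ x, poissonBracket B H₀ x ^ 2 ∂gibbsMeasure M β H₀ +
        (h ^ 2 + h) * ∫ x, poissonBracket B A x ^ 2 ∂gibbsMeasure M β H₀ +
        ε / 2 * (8 * ∫ x, (poissonBracket B H₀ x ^ 2) ^ 2 ∂gibbsMeasure M β H₀ +
          8 * ∫ x, (poissonBracket B A x ^ 2) ^ 2 ∂gibbsMeasure M β H₀ + 1)) ≤
      2 * ∫ x, B x ^ 2 ∂gibbsMeasure M β H₀ -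
        ε / 2 * (∫ x, (B x ^ 2) ^ 2 ∂gibbsMeasure M β H₀ + 1)) :
    (T : EReal) ≤ relaxationTime M B ρ := by
  set μ := gibbsMeasure M β H₀
  set P := poissonBracket B H₀
  set Q := poissonBracket B A
  set κ := (1 + h) * ∫ x, P x ^ 2 ∂μ + (h ^ 2 + h) * ∫ x, Q x ^ 2 ∂μ +
        ε / 2 * (8 * ∫ x, (P x ^ 2) ^ 2 ∂μ + 8 * ∫ x, (Q x ^ 2) ^ 2 ∂μ + 1) with hκdef
  set G := poissonBracket B fun x => H₀ x - h * A x
  have hH := contDiffOn_sub_const_mul (h := h) hH₀ hA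
  have hX := locallyLipschitzOn_hamiltonianVectorField hM hH
  have hB1 : ContDiffOn ℝ 1 B M := hBdef ▸ contDiffOn_poissonBracket hM hA hH₀
  have hGc : ContinuousOn G M := continuousOn_poissonBracket hM hB1 (hH.of_le one_le_two)
  have hmem : ∀ᵐ x ∂μ, x ∈ M := ae_gibbsMeasure_mem hM
  have hflow := hφ.continuousOn_uncurry hM hX
  have hmaps : MapsTo (fun z : ℝ × PhaseSpace n => φ z.1 z.2) (univ ×ˢ M) M :=
    fun z hz => hφ.map_mem _ _ hz.2
  have hmφ : ∀ {f : PhaseSpace n → ℝ}, ContinuousOn f M → ∀ s,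
      AEStronglyMeasurable (fun x => f (φ s x)) μ := fun hf s =>
    aestronglyMeasurable_gibbsMeasure hM
      (hf.comp (hφ.continuousOn hM hX s) fun x hx => hφ.map_mem s x hx)
  have hm : ∀ {f : PhaseSpace n → ℝ}, ContinuousOn f M → AEStronglyMeasurable f μ :=
    fun hf => aestronglyMeasurable_gibbsMeasure hM hf
  have hcomp := fun {F : PhaseSpace n → ℝ} (hF : ContinuousOn F M) (hF2) (s : ℝ) =>
    gibbsMeasure_integral_comp hM hH₀ hA hφ h₁ h₂ hε hle (hm hF) hF2 s
  -- the second and fourth moments of `G`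
  have hGM : ∀ᵐ x ∂μ, G x = P x - h * Q x := by
    filter_upwards [hmem] with x hx
    exact poissonBracket_sub_const_mul
      ((hH₀.contDiffAt (hM.mem_nhds hx)).differentiableAt two_ne_zero)
      ((hA.contDiffAt (hM.mem_nhds hx)).differentiableAt two_ne_zero) h
  have hG2 : ∫ x, G x ^ 2 ∂μ ≤ (1 + h) * ∫ x, P x ^ 2 ∂μ + (h ^ 2 + h) * ∫ x, Q x ^ 2 ∂μ := by
    rw [← integral_const_mul, ← integral_const_mul,
      ← integral_add (hP2.const_mul _) (hQ2.const_mul _)]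
    refine integral_mono_of_nonneg (.of_forall fun _ => sq_nonneg _)
      ((hP2.const_mul _).add (hQ2.const_mul _)) ?_
    filter_upwards [hGM] with x hx
    simp only [hx]
    -- The difference of the two sides is exactly `h (P + Q)²`; the coefficient of `P²` must tend to
    -- 1 to keep the sharp constant.
    nlinarith [mul_nonneg hh.le (sq_nonneg (P x + Q x))]
  -- A crude constant suffices here, because the fourth moments are multiplied by `ε`.
  have hG4le : ∀ᵐ x ∂μ, (G x ^ 2) ^ 2 ≤ 8 * (P x ^ 2) ^ 2 + 8 * (Q x ^ 2) ^ 2 := by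
    filter_upwards [hGM] with x hx
    have hsq : G x ^ 2 ≤ 2 * P x ^ 2 + 2 * Q x ^ 2 := by
      have : h ^ 2 * Q x ^ 2 ≤ 1 * Q x ^ 2 := by
        gcongr
        exact pow_le_one₀ hh.le hh1
      rw [hx]
      nlinarith [sq_nonneg (P x + h * Q x)]
    calc (G x ^ 2) ^ 2 ≤ (2 * P x ^ 2 + 2 * Q x ^ 2) ^ 2 := by gcongr
      _ ≤ _ := by nlinarith [sq_nonneg (P x ^ 2 - Q x ^ 2)]
  have hPQ : Integrable (fun x => 8 * (P x ^ 2) ^ 2 + 8 * (Q x ^ 2) ^ 2) μ :=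
    (hP4.const_mul 8).add (hQ4.const_mul 8)
  have hG4i : Integrable (fun x => (G x ^ 2) ^ 2) μ := by
    refine hPQ.mono' (hm ((hGc.pow 2).pow 2)) ?_
    filter_upwards [hG4le] with x hx
    rwa [Real.norm_of_nonneg (sq_nonneg _)]
  have hG4 : ∫ x, (G x ^ 2) ^ 2 ∂μ ≤ 8 * ∫ x, (P x ^ 2) ^ 2 ∂μ + 8 * ∫ x, (Q x ^ 2) ^ 2 ∂μ := by
    rw [← integral_const_mul, ← integral_const_mul,
      ← integral_add (hP4.const_mul _) (hQ4.const_mul _)]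
    exact integral_mono_ae hG4i hPQ hG4le
  have hGφ := hcomp (hGc.pow 2) hG4i
  have hκ : ∀ s, ∫ x, G (φ s x) ^ 2 ∂μ ≤ κ := fun s => by
    have h3 := (abs_le.1 (hGφ s).2).2
    have h4 : ε / 2 * (∫ x, (G x ^ 2) ^ 2 ∂μ + 1) ≤
        ε / 2 * (8 * ∫ x, (P x ^ 2) ^ 2 ∂μ + 8 * ∫ x, (Q x ^ 2) ^ 2 ∂μ + 1) := by gcongr
    rw [hκdef]
    simp only [Pi.pow_apply] at h3
    linarith
  -- the motion of `B`
  have hBφ := hcomp (hB1.continuousOn.pow 2) hB4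
  have hBφ2 : ∀ s, Integrable (fun x => B (φ s x) ^ 2) μ := fun s => (hBφ s).1
  have hB2 : Integrable (fun x => B x ^ 2) μ := by simpa only [hφ.map_zero] using hBφ2 0
  have hderiv : ∀ x ∈ M, ∀ s, HasDerivAt (fun s => B (φ s x)) (G (φ s x)) s := fun x hx s =>
    hφ.hasDerivAt_comp hx s
      ((hB1.contDiffAt (hM.mem_nhds (hφ.map_mem s x hx))).differentiableAt one_ne_zero)
  have hcontG : ∀ x ∈ M, Continuous fun s => G (φ s x) := fun x hx =>
    hGc.comp_continuous (hφ.continuous_time x) fun s => hφ.map_mem s x hx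
  have hsub := integral_sq_sub_le (μ := μ) (φ := φ) (b := B) (g := G)
    ((hGc.comp hflow hmaps).aestronglyMeasurable_prod hM hmem)
    (hmem.mono hcontG)
    (hmem.mono fun x hx r s => (intervalIntegral.integral_eq_sub_of_hasDerivAt
      (fun u _ => hderiv x hx u) ((hcontG x hx).intervalIntegrable _ _)).symm)
    (fun s => (hGφ s).1) hκ
  have hBm := hm hB1.continuousOn
  have hBmφ := hmφ hB1.continuousOn
  -- the autocorrelation function
  have hBB : ∀ s, Integrable (fun x => B x * B (φ s x)) μ := fun s =>
    Integrable.mul_of_sq hBm (hBmφ s) hB2 (hBφ2 s)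
  have hD : ∀ s, ∫ x, |B x * B (φ s x)| ∂μ ≤ 1 / 2 * (∫ x, B x ^ 2 ∂μ +
      (∫ x, B x ^ 2 ∂μ + ε / 2 * (∫ x, (B x ^ 2) ^ 2 ∂μ + 1))) := fun s => by
    have h3 := abs_integral_mul_le (μ := μ) (f := fun x => |B x|) (g := fun x => |B (φ s x)|)
      (by simpa only [sq_abs] using hB2) (by simpa only [sq_abs] using hBφ2 s) one_pos
    simp only [sq_abs, ← abs_mul, inv_one, one_mul] at h3
    have h4 := (abs_le.1 (hBφ s).2).2
    simp only [Pi.pow_apply] at h4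
    have h5 := le_abs_self (∫ x, |B x * B (φ s x)| ∂μ)
    linarith
  have hBi : ∀ s, Integrable (fun x => B (φ s x)) μ := fun s =>
    ((memLp_two_iff_integrable_sq (hBmφ s)).2 (hBφ2 s)).integrable (by norm_num)
  set C : ℝ → ℝ := fun s => ∫ x, B x * B (φ s x) ∂μ
  -- Continuity of `C` lets the fundamental theorem of calculus identify the derivative of
  -- `deltaMean` with `β * h * C t`.
  have hC : Continuous C := by
    refine (LipschitzWith.of_dist_le' (K := 1 / 2 * (∫ x, B x ^ 2 ∂μ + κ))
      fun s r => ?_).continuous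
    exact abs_integral_mul_sub_le hsub hBm hB2 hBmφ hBφ2 r s
  have hCpos : ∀ t, 0 < t → t < T → 0 ≤ C t := fun t ht htT => by
    have h3 := le_integral_mul_comp hφ.map_zero hsub hBm hB2 hBmφ hBφ2 t
    have h4 := (abs_le.1 (hBφ t).2).1
    have h5 := hT t ht htT
    simp only [Pi.pow_apply] at h4
    change 0 ≤ ∫ x, B x * B (φ t x) ∂μ
    linarith
  refine le_relaxationTime (integrableOn_mul_liouville hM hH₀ hA hφ hρ le_rfl (hBi 0))
    fun t ht htT => ⟨integrableOn_mul_liouville hM hH₀ hA hφ hρ ht.le (hBi t), β * h * C t,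
      mul_nonneg (by positivity) (hCpos t ht htT), ?_⟩
  have hev : deltaMean M B ρ =ᶠ[𝓝 t] fun t => β * h * ∫ s in 0..t, C s := by
    filter_upwards [Ioi_mem_nhds ht] with s hs
    exact deltaMean_eq hM hH₀ hA hφ hρ hBdef hBi hBB hD (le_of_lt hs)
  refine HasDerivAt.congr_of_eventuallyEq ?_ hev
  exact (intervalIntegral.integral_hasDerivAt_right (hC.intervalIntegrable _ _)
    (hC.stronglyMeasurableAtFilter _ _) hC.continuousAt).const_mul _

theorem le_relaxationTime_of_eq_zero (hB : ∀ x ∈ M, B x = 0) (hM : IsOpen M) (T : ℝ) :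
    (T : EReal) ≤ relaxationTime M B ρ := by
  have hz : ∀ t, EqOn (fun x => B x * ρ t x) (fun _ => 0) M := fun t x hx => by simp [hB x hx]
  have hi : ∀ t, IntegrableOn (fun x => B x * ρ t x) M := fun t =>
    integrableOn_zero.congr_fun (hz t).symm hM.measurableSet
  refine le_relaxationTime (hi 0) fun t _ _ => ⟨hi t, 0, le_rfl, ?_⟩
  have : deltaMean M B ρ = fun _ => 0 := funext fun t => by
    simp [deltaMean, setIntegral_congr_fun hM.measurableSet (hz _)]
  rw [this]
  exact hasDerivAt_const t 0

end RelaxationTime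

/-! ### Exponential moments near zero. -/

section Moments

variable {Ω : Type*} [MeasurableSpace Ω] {μ : Measure Ω}

theorem eLpNorm_two_eq_ofReal_sqrt {f : Ω → ℝ} (hf : MemLp f 2 μ) :
    eLpNorm f 2 μ = ENNReal.ofReal (Real.sqrt (∫ x, f x ^ 2 ∂μ)) := by
  rw [hf.eLpNorm_eq_integral_rpow_norm (by norm_num) (by norm_num), Real.sqrt_eq_rpow]
  norm_num

theorem exp_mul_le_add {δ c : ℝ} (hc : |c| ≤ δ) (a : ℝ) :
    Real.exp (c * a) ≤ Real.exp (δ * a) + Real.exp (-δ * a) := by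
  obtain ⟨h1, h2⟩ := abs_le.1 hc
  rcases le_total 0 a with h | h
  · exact (Real.exp_le_exp.2 (mul_le_mul_of_nonneg_right h2 h)).trans
      (le_add_of_nonneg_right (Real.exp_pos _).le)
  · exact (Real.exp_le_exp.2 (mul_le_mul_of_nonpos_right h1 h)).trans
      (le_add_of_nonneg_left (Real.exp_pos _).le)

theorem integrable_exp_mul_of_abs_le {A : Ω → ℝ} (hA : AEStronglyMeasurable A μ) {δ c : ℝ}
    (h₁ : Integrable (fun x => Real.exp (δ * A x)) μ)
    (h₂ : Integrable (fun x => Real.exp (-δ * A x)) μ) (hc : |c| ≤ δ) :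
    Integrable (fun x => Real.exp (c * A x)) μ := by
  refine (h₁.add h₂).mono' (Real.continuous_exp.comp_aestronglyMeasurable (hA.const_mul c))
    (.of_forall fun x => ?_)
  rw [Real.norm_of_nonneg (Real.exp_pos _).le]
  exact exp_mul_le_add hc _

/-- Dominated convergence: for `|c| < δ` the integrands lie below `exp (δ A) + exp (-δ A)`. -/
theorem tendsto_integral_exp_mul [IsProbabilityMeasure μ] {A : Ω → ℝ}
    (hA : AEStronglyMeasurable A μ) {δ : ℝ} (hδ : 0 < δ)
    (h₁ : Integrable (fun x => Real.exp (δ * A x)) μ)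
    (h₂ : Integrable (fun x => Real.exp (-δ * A x)) μ) :
    Tendsto (fun c : ℝ => ∫ x, Real.exp (c * A x) ∂μ) (𝓝 0) (𝓝 1) := by
  have h1 : ∫ x, Real.exp (0 * A x) ∂μ = 1 := by simp
  rw [← h1]
  refine tendsto_integral_filter_of_dominated_convergence
    (fun x => Real.exp (δ * A x) + Real.exp (-δ * A x))
    (.of_forall fun c => Real.continuous_exp.comp_aestronglyMeasurable (hA.const_mul c)) ?_
    (h₁.add h₂) (.of_forall fun x => ?_)
  · have : ∀ᶠ c : ℝ in 𝓝 0, |c| < δ :=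
      continuous_abs.continuousAt.eventually_lt continuousAt_const (by simpa using hδ)
    filter_upwards [this] with c hc
    refine .of_forall fun x => ?_
    rw [Real.norm_of_nonneg (Real.exp_pos _).le]
    exact exp_mul_le_add hc.le _
  · exact (Real.continuous_exp.comp (continuous_id.mul continuous_const)).tendsto 0

theorem le_sq_sqrt_add {e h : ℝ} (hh : 0 ≤ h) : e ≤ (Real.sqrt e + h) ^ 2 := by
  rcases le_total 0 e with he | he
  · nlinarith [Real.sq_sqrt he, Real.sqrt_nonneg e, mul_nonneg (Real.sqrt_nonneg e) hh]
  · exact he.trans (sq_nonneg _)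

end Moments

/-! ### From norms in `[0, ∞]` to integrals. -/

section GibbsNorm

variable {n : ℕ} {M : Set (PhaseSpace n)} {β : ℝ} {H₀ : PhaseSpace n → ℝ}

theorem integrable_sq_of_gibbsNorm_lt_top (hM : IsOpen M) {f : PhaseSpace n → ℝ}
    (hf : ContinuousOn f M) (h : gibbsNorm M β H₀ f < ⊤) :
    Integrable (fun x => f x ^ 2) (gibbsMeasure M β H₀) :=
  MemLp.integrable_sq ⟨aestronglyMeasurable_gibbsMeasure hM hf, h⟩

theorem integrable_of_integrable_sq [IsFiniteMeasure (gibbsMeasure M β H₀)] (hM : IsOpen M)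
    {f : PhaseSpace n → ℝ} (hf : ContinuousOn f M)
    (h : Integrable (fun x => f x ^ 2) (gibbsMeasure M β H₀)) :
    Integrable f (gibbsMeasure M β H₀) :=
  ((memLp_two_iff_integrable_sq (aestronglyMeasurable_gibbsMeasure hM hf)).2 h).integrable
    (by norm_num)

theorem integral_sq_le_of_gibbsNorm_le (hM : IsOpen M) {f g : PhaseSpace n → ℝ}
    (hf : ContinuousOn f M) (hg : ContinuousOn g M)
    (hf2 : Integrable (fun x => f x ^ 2) (gibbsMeasure M β H₀))
    (hg2 : Integrable (fun x => g x ^ 2) (gibbsMeasure M β H₀)) {η : ℝ} (hη : 0 ≤ η)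
    (h : gibbsNorm M β H₀ f ≤ ENNReal.ofReal η * gibbsNorm M β H₀ g) :
    ∫ x, f x ^ 2 ∂gibbsMeasure M β H₀ ≤ η ^ 2 * ∫ x, g x ^ 2 ∂gibbsMeasure M β H₀ := by
  have hF := (memLp_two_iff_integrable_sq (aestronglyMeasurable_gibbsMeasure hM hf)).2 hf2
  have hG := (memLp_two_iff_integrable_sq (aestronglyMeasurable_gibbsMeasure hM hg)).2 hg2
  unfold gibbsNorm at h
  rw [eLpNorm_two_eq_ofReal_sqrt hF, eLpNorm_two_eq_ofReal_sqrt hG, ← ENNReal.ofReal_mul hη,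
    ENNReal.ofReal_le_ofReal_iff (by positivity)] at h
  have h2 := pow_le_pow_left₀ (Real.sqrt_nonneg _) h 2
  rwa [mul_pow, Real.sq_sqrt (integral_nonneg fun _ => sq_nonneg _),
    Real.sq_sqrt (integral_nonneg fun _ => sq_nonneg _)] at h2

/-- The Gibbs density is positive, so a null set for it is Lebesgue null in `M`, and a continuous
function vanishing almost everywhere on an open set vanishes there. -/
theorem integral_sq_pos (hM : IsOpen M) (hne : M.Nonempty) (hH₀ : ContinuousOn H₀ M)
    (hZ : IntegrableOn (fun x => Real.exp (-β * H₀ x)) M) {f : PhaseSpace n → ℝ}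
    (hf : ContinuousOn f M) (hf2 : Integrable (fun x => f x ^ 2) (gibbsMeasure M β H₀))
    (hf0 : ∃ x ∈ M, f x ≠ 0) : 0 < ∫ x, f x ^ 2 ∂gibbsMeasure M β H₀ := by
  refine lt_of_le_of_ne (integral_nonneg fun _ => sq_nonneg _) fun h0 => ?_
  have h1 := (integral_eq_zero_iff_of_nonneg (fun _ => sq_nonneg _) hf2).1 h0.symm
  have hac : volume.restrict M ≪ gibbsMeasure M β H₀ :=
    withDensity_absolutelyContinuous' (aemeasurable_gibbsDensity hM hH₀).ennreal_ofReal
      (.of_forall fun x => (ENNReal.ofReal_pos.2 (gibbsDensity_pos hM hne hZ x)).ne')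
  have h2 : f =ᵐ[volume.restrict M] fun _ => 0 := by
    filter_upwards [hac.ae_le h1] with x hx
    simpa using hx
  obtain ⟨x, hx, hfx⟩ := hf0
  exact hfx (Measure.eqOn_open_of_ae_eq h2 hM hf continuousOn_const hx)

theorem integrable_exp_of_lintegral_lt (hM : IsOpen M) {f : PhaseSpace n → ℝ}
    (hf : ContinuousOn f M) {K : ENNReal}
    (h : ∫⁻ x, ENNReal.ofReal (Real.exp (f x)) ∂gibbsMeasure M β H₀ < K) :
    Integrable (fun x => Real.exp (f x)) (gibbsMeasure M β H₀) := by
  refine (lintegral_ofReal_ne_top_iff_integrable ?_ (.of_forall fun x => (Real.exp_pos _).le)).1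
    (h.trans_le le_top).ne
  exact Real.continuous_exp.comp_aestronglyMeasurable (aestronglyMeasurable_gibbsMeasure hM hf)

end GibbsNorm

/-! ### The limit of weak perturbations. -/

theorem sqrt_two_mul_div {b η : ℝ} (hb : 0 < b) (hη : 0 < η) :
    Real.sqrt (2 * b / (η ^ 2 * b)) = Real.sqrt 2 / η := by
  rw [mul_div_mul_right _ _ hb.ne', Real.sqrt_div zero_le_two, Real.sqrt_sq hη.le]

theorem theorem1 (n : ℕ) (M : Set (PhaseSpace n)) (hM : IsOpen M)
    (β : ℝ) (hβ : 0 < β) (H₀ A : PhaseSpace n → ℝ)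
    (hH₀ : ContDiffOn ℝ 2 H₀ M) (hA : ContDiffOn ℝ 2 A M)
    (hH₀_even : EvenInMomenta M H₀) (hA_even : EvenInMomenta M A)
    (hH₀_bdd : ∃ D : ℝ, ∀ x ∈ M, D ≤ H₀ x)
    (hZ : IntegrableOn (fun x => Real.exp (-β * H₀ x)) M)
    (hflow : ∀ᶠ h : ℝ in 𝓝[>] 0, HasGlobalFlow M (fun x => H₀ x - h * A x))
    (hexp : ∃ δ : ℝ, 0 < δ ∧ ∃ K : ℝ, 0 < K ∧
      ∫⁻ x, ENNReal.ofReal (Real.exp (δ * A x)) ∂(gibbsMeasure M β H₀) < ENNReal.ofReal K ∧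
      ∫⁻ x, ENNReal.ofReal (Real.exp (-δ * A x)) ∂(gibbsMeasure M β H₀) < ENNReal.ofReal K)
    (B : PhaseSpace n → ℝ) (hB : B = poissonBracket A H₀)
    (hB4 : gibbsNorm M β H₀ (fun x => B x ^ 4) < ⊤)
    (hBH : gibbsNorm M β H₀ (fun x => poissonBracket B H₀ x ^ 2) < ⊤)
    (hBA : gibbsNorm M β H₀ (fun x => poissonBracket B A x ^ 2) < ⊤)
    (η : ℝ) (hη : 0 < η)
    (hBη : gibbsNorm M β H₀ (poissonBracket B H₀) ≤ ENNReal.ofReal η * gibbsNorm M β H₀ B)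
    (ρ : ℝ → ℝ → PhaseSpace n → ℝ)
    (hρ : ∀ᶠ h : ℝ in 𝓝[>] 0,
      IsLiouvilleSolution M (fun x => H₀ x - h * A x) (gibbsDensity M β H₀) (ρ h)) :
    ∃ r : ℝ → ℝ, Tendsto r (𝓝[>] 0) (𝓝 0) ∧
      ∀ᶠ h : ℝ in 𝓝[>] 0,
        ((Real.sqrt 2 / η + r h : ℝ) : EReal) ≤ relaxationTime M B (ρ h) := by
  -- If `B` vanishes on `M`, every `T` is admissible. Otherwise `M` is nonempty and `∫ B²` is
  -- positive, as needed to divide by it.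
  by_cases hB0 : ∀ x ∈ M, B x = 0
  · exact ⟨fun _ => 0, tendsto_const_nhds, .of_forall fun h => le_relaxationTime_of_eq_zero hB0 hM _⟩
  push Not at hB0
  have hne : M.Nonempty := ⟨hB0.choose, hB0.choose_spec.1⟩
  have := isProbabilityMeasure_gibbsMeasure hM hne hZ
  obtain ⟨δ, hδ, K, -, hK₁, hK₂⟩ := hexp
  set μ := gibbsMeasure M β H₀
  have hB1 : ContDiffOn ℝ 1 B M := hB ▸ contDiffOn_poissonBracket hM hA hH₀
  have hBc := hB1.continuousOn
  have hPc : ContinuousOn (poissonBracket B H₀) M :=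
    continuousOn_poissonBracket hM hB1 (hH₀.of_le one_le_two)
  have hQc : ContinuousOn (poissonBracket B A) M :=
    continuousOn_poissonBracket hM hB1 (hA.of_le one_le_two)
  have hAm : AEStronglyMeasurable A μ := aestronglyMeasurable_gibbsMeasure hM hA.continuousOn
  have hδ₁ : Integrable (fun x => Real.exp (δ * A x)) μ :=
    integrable_exp_of_lintegral_lt hM (continuousOn_const.mul hA.continuousOn) hK₁
  have hδ₂ : Integrable (fun x => Real.exp (-δ * A x)) μ :=
    integrable_exp_of_lintegral_lt hM (continuousOn_const.mul hA.continuousOn) hK₂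
  have hB4' : Integrable (fun x => (B x ^ 2) ^ 2) μ := by
    simpa only [← pow_mul] using integrable_of_integrable_sq (f := fun x => B x ^ 4) hM (hBc.pow 4)
      (integrable_sq_of_gibbsNorm_lt_top hM (hBc.pow 4) hB4)
  have hB2 : Integrable (fun x => B x ^ 2) μ := integrable_of_integrable_sq hM (hBc.pow 2) hB4'
  have hP4 := integrable_sq_of_gibbsNorm_lt_top hM (hPc.pow 2) hBH
  have hQ4 := integrable_sq_of_gibbsNorm_lt_top hM (hQc.pow 2) hBA
  have hP2 := integrable_of_integrable_sq hM (hPc.pow 2) hP4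
  have hQ2 := integrable_of_integrable_sq hM (hQc.pow 2) hQ4
  have hPη := integral_sq_le_of_gibbsNorm_le hM hPc hBc hP2 hB2 hη.le hBη
  have hb := integral_sq_pos hM hne hH₀.continuousOn hZ hBc hB2 hB0
  set b := ∫ x, B x ^ 2 ∂μ
  set I : ℝ → ℝ := fun c => ∫ x, Real.exp (c * A x) ∂μ
  have hI : Tendsto I (𝓝 0) (𝓝 1) := tendsto_integral_exp_mul hAm hδ hδ₁ hδ₂
  have hid : Tendsto (fun h : ℝ => h) (𝓝[>] 0) (𝓝 0) := nhdsWithin_le_nhds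
  have hlin : ∀ a : ℝ, Tendsto (fun h : ℝ => a * h) (𝓝[>] 0) (𝓝 0) := fun a => by
    simpa using hid.const_mul a
  -- The square root makes `1 + ε²` dominate the exponential moments, whatever the sign of its
  -- argument; the summand `h` makes `ε` strictly positive.
  set ε : ℝ → ℝ := fun h => Real.sqrt (1 / 2 * (I (3 * β * h) + I (-(3 * β * h))) - 1) + h
  have hε : Tendsto ε (𝓝[>] 0) (𝓝 0) := by
    have hn : Tendsto (fun h => -(3 * β * h)) (𝓝[>] 0) (𝓝 0) := by simpa using (hlin (3 * β)).neg
    have h1 := (((((hI.comp (hlin (3 * β))).add (hI.comp hn)).const_mul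
      (1 / 2)).sub_const 1).sqrt).add hid
    norm_num at h1
    simpa [ε] using h1
  -- `κ` and `m` are continuous in `(h, ε)`, so their limits are the values `η ^ 2 * b` and `2 * b`
  -- at the origin.
  set κ : ℝ × ℝ → ℝ := fun z => (1 + z.1) * (η ^ 2 * b) +
    (z.1 ^ 2 + z.1) * ∫ x, poissonBracket B A x ^ 2 ∂μ +
    z.2 / 2 * (8 * ∫ x, (poissonBracket B H₀ x ^ 2) ^ 2 ∂μ +
      8 * ∫ x, (poissonBracket B A x ^ 2) ^ 2 ∂μ + 1) with hκdef
  set m : ℝ × ℝ → ℝ := fun z => 2 * b - z.2 / 2 * (∫ x, (B x ^ 2) ^ 2 ∂μ + 1)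
  have hz : Tendsto (fun h => (h, ε h)) (𝓝[>] 0) (𝓝 ((0, 0) : ℝ × ℝ)) := hid.prodMk_nhds hε
  have hκ : Tendsto (fun h => κ (h, ε h)) (𝓝[>] 0) (𝓝 (η ^ 2 * b)) := by
    have h1 : Continuous κ := by fun_prop
    simpa [κ, Function.comp_def] using (h1.tendsto (0, 0)).comp hz
  have hm : Tendsto (fun h => m (h, ε h)) (𝓝[>] 0) (𝓝 (2 * b)) := by
    have h1 : Continuous m := by fun_prop
    simpa [m, Function.comp_def] using (h1.tendsto (0, 0)).comp hz
  have hκ0 : 0 < η ^ 2 * b := by positivity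
  -- The autocorrelation is nonnegative while `t² κ ≤ m`, so `√(m / κ)` is the time bound; its limit
  -- is `√(2 b / (η² b)) = √2 / η`.
  refine ⟨fun h => Real.sqrt (m (h, ε h) / κ (h, ε h)) - Real.sqrt 2 / η, ?_, ?_⟩
  · have h1 := (hm.div hκ hκ0.ne').sqrt
    rw [sqrt_two_mul_div hb hη] at h1
    simpa using h1.sub_const (Real.sqrt 2 / η)
  have hδ3 : ∀ᶠ h : ℝ in 𝓝[>] 0, |3 * β * h| < δ := by
    have h1 := (hlin (3 * β)).abs
    rw [abs_zero] at h1
    exact h1.eventually_lt_const hδ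
  filter_upwards [hflow, hρ, hκ.eventually_const_lt hκ0, hδ3, self_mem_nhdsWithin,
    hid.eventually_le_const zero_lt_one] with h hfl hρh hκh hδh (hh : 0 < h) hh1
  obtain ⟨φ, hφ⟩ := exists_isCompleteFlow hfl
  rw [add_sub_cancel]
  have e₁ : ∀ x, 3 * (β * h) * A x = 3 * β * h * A x := fun x => by ring
  have e₂ : ∀ x, -(3 * (β * h) * A x) = -(3 * β * h) * A x := fun x => by ring
  have hε0 : 0 < ε h := add_pos_of_nonneg_of_pos (Real.sqrt_nonneg _) hh
  refine le_relaxationTime_of_forall_sq_mul_le hM hβ hH₀ hA hh hh1 hφ hρh hB ?_ ?_ hε0 ?_ hB4' hP2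
    hP4 hQ2 hQ4 fun t ht htT => ?_
  · simp only [e₁]
    exact integrable_exp_mul_of_abs_le hAm hδ₁ hδ₂ hδh.le
  · simp only [e₂]
    refine integrable_exp_mul_of_abs_le hAm hδ₁ hδ₂ ?_
    rw [abs_neg]
    exact hδh.le
  · simp only [e₂]
    simp only [e₁]
    have := le_sq_sqrt_add (e := 1 / 2 * (I (3 * β * h) + I (-(3 * β * h))) - 1) hh.le
    change 1 / 2 * (I (3 * β * h) + I (-(3 * β * h))) ≤ 1 + ε h ^ 2
    linarith
  · have h1 : t ^ 2 * κ (h, ε h) ≤ m (h, ε h) :=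
      -- The remaining comparison replaces `∫ [B, H₀]²` by its bound `η² b`, the only use of the
      -- assumption on `η`.
      ((lt_div_iff₀ hκh).1 ((Real.lt_sqrt ht.le).1 htT)).le
    refine le_trans ?_ h1
    simp only [hκdef]
    gcongr
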